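/- An overpartition of a nonnegative integer $n$ is a partition of $n$ in which the first occurrence of each distinct number may be overlined. Let $\overline{spt1}(n)$ (resp. $\overline{spt2}(n)$) denote the sum, over all overpartitions $\lambda$ of $n$ whose smallest part is odd (resp. even), of the number of occurrences (overlined or not) of the smallest part of $\lambda$; the empty overpartition of $0$ contributes $0$. Let $\overline{spt}(n) = \overline{spt1}(n) + \overline{spt2}(n)$. For example, $\overline{spt1}(4) = 20$, $\overline{spt2}(4) = 6$ and $\overline{spt}(4) = 26$. Then for every integer $n \geq 0$, $$\overline{spt2}(3n) \equiv \overline{spt2}(3n+1) \equiv 0 \pmod{3},$$ $$\overline{spt}(3n) \equiv 0 \pmod{3},$$ $$\overline{spt2}(5n+3) \equiv 0 \pmod{5},$$ and $$\overline{spt1}(5n) \equiv 0 \pmod{5}.$$ -/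

import Mathlib

/-- An overpartition of `n`: a partition of `n` in which the first occurrence of each distinct
part may be overlined. It is recorded as the underlying partition together with the set of those
part sizes whose first occurrence is overlined. -/
structure Overpartition (n : ℕ) where
  partition : n.Partition
  overlined : Finset ℕ
  overlined_subset : overlined ⊆ partition.parts.toFinset

namespace Overpartition

/-- An overpartition is a partition with a subset of its set of part sizes. -/
def equivSigma (n : ℕ) :
    Overpartition n ≃ Σ p : n.Partition, {S : Finset ℕ // S ∈ p.parts.toFinset.powerset} where
  toFun l := ⟨l.partition, l.overlined, Finset.mem_powerset.mpr l.overlined_subset⟩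
  invFun x := ⟨x.1, x.2.1, Finset.mem_powerset.mp x.2.2⟩
  left_inv _ := rfl
  right_inv _ := rfl

instance instFintype (n : ℕ) : Fintype (Overpartition n) :=
  Fintype.ofEquiv _ (equivSigma n).symm

/-- The smallest part (as a number) of an overpartition; `0` for the empty overpartition,
which has no parts. -/
def smallestPart {n : ℕ} (l : Overpartition n) : ℕ :=
  l.partition.parts.toFinset.min.untopD 0

/-- The number of occurrences of the smallest part, overlined or not; `0` for the empty
overpartition. -/
def smallestPartCount {n : ℕ} (l : Overpartition n) : ℕ :=
  l.partition.parts.count l.smallestPart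

end Overpartition

/-- The sum, over all overpartitions of `n` whose smallest part is odd, of the number of
occurrences of the smallest part. -/
def sptBar1 (n : ℕ) : ℕ :=
  ∑ l : Overpartition n, if Odd l.smallestPart then l.smallestPartCount else 0

/-- The sum, over all overpartitions of `n` whose smallest part is even, of the number of
occurrences of the smallest part. -/
def sptBar2 (n : ℕ) : ℕ :=
  ∑ l : Overpartition n, if Even l.smallestPart then l.smallestPartCount else 0

/-- The sum, over all overpartitions of `n`, of the number of occurrences of the smallest part,
split by the parity of the smallest part. -/
def sptBar (n : ℕ) : ℕ :=
  sptBar1 n + sptBar2 n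

/-!
Write `θ = ∑ (-1)^t q^(t^2)`, `D = q d/dq`, `S_k(q) = ∑ σ_k(n) q^n` and
`R_k = ∑ (-1)^a m^k q^(a^2 + 2am)` over positive integers `a`, `m`. Gauss' product gives
`θ = ∏ (1 - q^n) / (1 + q^n)`, and Bailey's lemma turns the generating functions of the smallest
parts functions into `θ ∑ spt2(n) q^n = 2 S_1(q^2) + 4 R_1` and
`θ ∑ spt(n) q^n = 2 S_1(q) - 4 S_1(q^2) + 8 R_1`.

The rank series `R_1`, `R_3` are mock objects, but they satisfy heat equations:
`θ D R_k + θ R_(k+2) - R_k D θ` is a polynomial in derivatives of `θ` and of divisor series, because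
the corresponding ternary sum is almost antisymmetric under the exchange of `k` and `a + m` in
`q^(k^2 + a^2 + 2am)`. By Fermat's little theorem `R_3 = R_1` modulo `3` and `R_5 = R_1` modulo `5`,
so these equations close up. Together with `D θ = 2 (S_1(q^2) - S_1(q)) θ` and Ramanujan's
differential equation for `S_1` they give `spt2 + D spt2 = 0` and `spt - 2 spt2 = D (1 / θ)` modulo
`3`, and `spt2 = (D - 3) H`, `spt1 = D H'` modulo `5` with explicit `H`, `H'`; the coefficients in
the stated residue classes vanish.
-/

open PowerSeries

/-! ### Power series indexed by sets -/

/-- The power series `∑ i ∈ s, w i * q ^ e i`. The exponents are integers so that they can be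
changed by integral substitutions; the definition is meaningful when `QSummable s e` holds. -/
noncomputable def qSum {ι R : Type*} [CommRing R] (s : Set ι) (e : ι → ℤ) (w : ι → R) : R⟦X⟧ :=
  PowerSeries.mk fun n => ∑ᶠ i ∈ {i ∈ s | e i = n}, w i

/-- Summability of `∑ i ∈ s, w i * q ^ e i` for arbitrary coefficients: the exponents are
nonnegative and finitely many of them lie below any given bound. -/
structure QSummable {ι : Type*} (s : Set ι) (e : ι → ℤ) : Prop where
  nonneg : ∀ i ∈ s, 0 ≤ e i
  finite_le : ∀ N : ℤ, {i ∈ s | e i ≤ N}.Finite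

namespace QSummable

variable {ι κ : Type*} {s t : Set ι} {e f : ι → ℤ}

theorem mono (h : QSummable t e) (hst : s ⊆ t) : QSummable s e :=
  ⟨fun i hi => h.nonneg i (hst hi), fun N => (h.finite_le N).subset fun _ hi => ⟨hst hi.1, hi.2⟩⟩

theorem of_le (h : QSummable s f) (hfe : ∀ i ∈ s, f i ≤ e i) : QSummable s e :=
  ⟨fun i hi => (h.nonneg i hi).trans (hfe i hi),
    fun N => (h.finite_le N).subset fun i hi => ⟨hi.1, (hfe i hi.1).trans hi.2⟩⟩

theorem finite_eq (h : QSummable s e) (N : ℤ) : {i ∈ s | e i = N}.Finite :=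
  (h.finite_le N).subset fun _ hi => ⟨hi.1, hi.2.le⟩

theorem preimage {t : Set κ} {f : κ → ℤ} (h : QSummable t f) (σ : ι ≃ κ)
    (hs : ∀ i ∈ s, σ i ∈ t) (he : ∀ i ∈ s, e i = f (σ i)) : QSummable s e :=
  ⟨fun i hi => he i hi ▸ h.nonneg _ (hs i hi),
    fun N => ((h.finite_le N).preimage σ.injective.injOn).subset
      fun i hi => ⟨hs i hi.1, he i hi.1 ▸ hi.2⟩⟩

theorem prod {t : Set κ} {f : κ → ℤ} (hs : QSummable s e) (ht : QSummable t f) :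
    QSummable (s ×ˢ t) fun p => e p.1 + f p.2 := by
  refine ⟨fun p hp => add_nonneg (hs.nonneg _ hp.1) (ht.nonneg _ hp.2), fun N => ?_⟩
  refine ((hs.finite_le N).prod (ht.finite_le N)).subset fun p hp => ?_
  have he := hs.nonneg _ hp.1.1
  have hf := ht.nonneg _ hp.1.2
  have hN := hp.2
  exact ⟨⟨hp.1.1, by linarith⟩, ⟨hp.1.2, by linarith⟩⟩

end QSummable

section QSum

variable {ι κ R S : Type*} [CommRing R] [CommRing S]
  {s t : Set ι} {u : Set κ} {e e' : ι → ℤ} {f : κ → ℤ} {w w' : ι → R} {v : κ → R}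

theorem coeff_qSum (s : Set ι) (e : ι → ℤ) (w : ι → R) (n : ℕ) :
    coeff n (qSum s e w) = ∑ᶠ i ∈ {i ∈ s | e i = n}, w i :=
  coeff_mk _ _

theorem coeff_qSum_eq_sum (F : Finset ι) (n : ℕ) (hF : ∀ i ∈ s, e i = n → i ∈ F)
    (hFs : ∀ i ∈ F, i ∈ s) : coeff n (qSum s e w) = ∑ i ∈ F, if e i = n then w i else 0 := by
  classical
  rw [coeff_qSum, ← Finset.sum_filter, ← finsum_mem_coe_finset]
  refine finsum_mem_congr ?_ fun _ _ => rfl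
  ext i
  simpa using fun h => ⟨fun hi => hF i hi h, hFs i⟩

theorem qSum_reindex (σ : ι ≃ κ) (hs : ∀ i, σ i ∈ u ↔ i ∈ s) (he : ∀ i ∈ s, f (σ i) = e i)
    (hw : ∀ i ∈ s, v (σ i) = w i) : qSum s e w = qSum u f v := by
  ext n
  rw [coeff_qSum, coeff_qSum]
  refine finsum_mem_eq_of_bijOn σ ⟨fun i hi => ⟨(hs i).2 hi.1, (he i hi.1).trans hi.2⟩,
    σ.injective.injOn, fun k hk => ?_⟩ fun i hi => (hw i hi.1).symm
  have hk' : σ.symm k ∈ s := (hs _).1 (by simpa using hk.1)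
  exact ⟨σ.symm k, ⟨hk', by rw [← he _ hk', σ.apply_symm_apply, hk.2]⟩, σ.apply_symm_apply k⟩

theorem qSum_congr (he : ∀ i ∈ s, e i = e' i) (hw : ∀ i ∈ s, w i = w' i) :
    qSum s e w = qSum s e' w' :=
  qSum_reindex (Equiv.refl ι) (fun _ => Iff.rfl) (fun i hi => (he i hi).symm)
    fun i hi => (hw i hi).symm

theorem qSum_congr_coeff (hw : ∀ i ∈ s, w i = w' i) : qSum s e w = qSum s e w' :=
  qSum_congr (fun _ _ => rfl) hw

theorem qSum_eq_zero (hw : ∀ i ∈ s, w i = 0) : qSum s e w = 0 := by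
  ext n
  rw [coeff_qSum, finsum_mem_congr rfl fun i hi => hw i hi.1, finsum_mem_zero, map_zero]

theorem qSum_of_subset (hst : s ⊆ t) (hw : ∀ i ∈ t, i ∉ s → w i = 0) :
    qSum t e w = qSum s e w := by
  ext n
  rw [coeff_qSum, coeff_qSum]
  refine finsum_mem_inter_support_eq' _ _ _ fun i hi =>
    ⟨fun h => ⟨?_, h.2⟩, fun h => ⟨hst h.1, h.2⟩⟩
  exact by_contra fun his => hi (hw i h.1 his)

theorem qSum_neg : qSum s e (fun i => -w i) = -qSum s e w := by
  ext n
  simp only [coeff_qSum, map_neg, finsum_neg_distrib]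

theorem qSum_eq_zero_of_antisymm [CharZero R] [NoZeroDivisors R] (σ : ι ≃ ι)
    (hs : ∀ i, σ i ∈ s ↔ i ∈ s) (he : ∀ i ∈ s, e (σ i) = e i)
    (hw : ∀ i ∈ s, w (σ i) = -w i) : qSum s e w = 0 := by
  have h : qSum s e w = -qSum s e w := by
    rw [← qSum_neg]
    exact (qSum_reindex σ hs he hw).symm
  ext n
  exact CharZero.eq_neg_self_iff.mp (congrArg (coeff n) h)

theorem qSum_add (hs : QSummable s e) :
    qSum s e (fun i => w i + w' i) = qSum s e w + qSum s e w' := by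
  ext n
  simp only [coeff_qSum, map_add, finsum_mem_add_distrib (hs.finite_eq n)]

theorem qSum_const_mul (hs : QSummable s e) (c : R) :
    qSum s e (fun i => c * w i) = C c * qSum s e w := by
  ext n
  rw [coeff_C_mul, coeff_qSum, coeff_qSum, mul_finsum_mem' _ _ (hs.finite_eq n)]

theorem qSum_inter_add_sdiff (hs : QSummable s e) (t : Set ι) :
    qSum (s ∩ t) e w + qSum (s \ t) e w = qSum s e w := by
  ext n
  rw [map_add, coeff_qSum, coeff_qSum, coeff_qSum, ← finsum_mem_inter_add_sdiff t (hs.finite_eq n)]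
  exact congrArg₂ _ (finsum_mem_congr (Set.ext fun i => by grind) fun _ _ => rfl)
    (finsum_mem_congr (Set.ext fun i => by grind) fun _ _ => rfl)

theorem qSum_mul (hs : QSummable s e) (hu : QSummable u f) :
    qSum s e w * qSum u f v =
      qSum (s ×ˢ u) (fun p => e p.1 + f p.2) fun p => w p.1 * v p.2 := by
  ext n
  let A (k : ℕ × ℕ) : Set (ι × κ) := {i ∈ s | e i = k.1} ×ˢ {j ∈ u | f j = k.2}
  have hA : {p ∈ s ×ˢ u | e p.1 + f p.2 = n} =
      ⋃ k ∈ Finset.HasAntidiagonal.antidiagonal n, A k := by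
    ext ⟨i, j⟩
    simp only [A, Set.mem_ofPred_eq, Set.mem_prod, Set.mem_iUnion,
      Finset.HasAntidiagonal.mem_antidiagonal, exists_prop, Prod.exists]
    refine ⟨fun ⟨⟨hi, hj⟩, _⟩ => ?_, fun ⟨a, b, _, hi, hj⟩ => ⟨⟨hi.1, hj.1⟩, by omega⟩⟩
    have := hs.nonneg i hi
    have := hu.nonneg j hj
    exact ⟨(e i).toNat, (f j).toNat, by omega, ⟨hi, by omega⟩, hj, by omega⟩
  have hdisj : (Finset.HasAntidiagonal.antidiagonal n : Set (ℕ × ℕ)).PairwiseDisjoint A := by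
    refine fun k _ l _ hkl => Set.disjoint_left.2 fun p hk hl => hkl ?_
    exact Prod.ext (by exact_mod_cast hk.1.2.symm.trans hl.1.2)
      (by exact_mod_cast hk.2.2.symm.trans hl.2.2)
  rw [coeff_mul, coeff_qSum, hA]
  erw [finsum_mem_biUnion hdisj (Finset.finite_toSet _)
    fun k _ => (hs.finite_eq _).prod (hu.finite_eq _)]
  rw [finsum_mem_coe_finset]
  refine Finset.sum_congr rfl fun k _ => ?_
  rw [coeff_qSum, coeff_qSum, finsum_mem_eq_finite_toFinset_sum _ (hs.finite_eq _),
    finsum_mem_eq_finite_toFinset_sum _ (hu.finite_eq _), Finset.sum_mul_sum,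
    ← Finset.sum_product', ← finsum_mem_coe_finset, Finset.coe_product, Set.Finite.coe_toFinset,
    Set.Finite.coe_toFinset]

theorem qSum_fiber (hs : QSummable s e) (g : ι → κ) (F : κ → Finset ι)
    (hF : ∀ k ∈ u, ∀ i, i ∈ F k ↔ i ∈ s ∧ g i = k) (hg : ∀ i ∈ s, g i ∈ u)
    (he : ∀ i ∈ s, e i = f (g i)) : qSum s e w = qSum u f fun k => ∑ i ∈ F k, w i := by
  ext n
  have hfib : {i ∈ s | e i = n} = ⋃ k ∈ {k ∈ g '' s | f k = n}, (F k : Set ι) := by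
    ext i
    simp only [Set.mem_ofPred_eq, Set.mem_iUnion, exists_prop, Finset.mem_coe]
    refine ⟨fun hi => ⟨g i, ⟨⟨i, hi.1, rfl⟩, he i hi.1 ▸ hi.2⟩, (hF _ (hg i hi.1) i).2 ⟨hi.1, rfl⟩⟩,
      ?_⟩
    rintro ⟨_, ⟨⟨j, hj, rfl⟩, hfj⟩, hi⟩
    obtain ⟨hi, hgi⟩ := (hF _ (hg j hj) i).1 hi
    exact ⟨hi, by rw [he i hi, hgi, hfj]⟩
  have hfin : {k ∈ g '' s | f k = n}.Finite := by
    refine ((hs.finite_eq n).image g).subset ?_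
    rintro _ ⟨⟨i, hi, rfl⟩, hf⟩
    exact ⟨i, ⟨hi, (he i hi).trans hf⟩, rfl⟩
  have hdisj : {k ∈ g '' s | f k = n}.PairwiseDisjoint fun k => (F k : Set ι) := by
    rintro _ ⟨⟨i, hi, rfl⟩, _⟩ _ ⟨⟨j, hj, rfl⟩, _⟩ hij
    refine Set.disjoint_left.2 fun l hl hl' => hij ?_
    rw [← ((hF _ (hg i hi) l).1 hl).2, ((hF _ (hg j hj) l).1 hl').2]
  rw [coeff_qSum, coeff_qSum, hfib, finsum_mem_biUnion hdisj hfin fun k _ => Finset.finite_toSet _]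
  simp only [finsum_mem_coe_finset]
  refine finsum_mem_inter_support_eq' _ _ _ fun k hne => ⟨?_, ?_⟩
  · rintro ⟨⟨i, hi, rfl⟩, hf⟩
    exact ⟨hg i hi, hf⟩
  · rintro ⟨hk, hfk⟩
    obtain ⟨i, hi, _⟩ := Finset.exists_ne_zero_of_sum_ne_zero hne
    obtain ⟨his, rfl⟩ := (hF k hk i).1 hi
    exact ⟨⟨i, his, rfl⟩, hfk⟩

theorem map_qSum (φ : R →+* S) (hs : QSummable s e) :
    PowerSeries.map φ (qSum s e w) = qSum s e fun i => φ (w i) := by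
  ext n
  rw [coeff_map, coeff_qSum, coeff_qSum]
  exact φ.toAddMonoidHom.map_finsum_mem _ (hs.finite_eq n)

theorem X_pow_mul_qSum (hs : QSummable s e) (k : ℕ) :
    X ^ k * qSum s e w = qSum s (fun i => k + e i) w := by
  ext n
  rw [coeff_qSum, coeff_X_pow_mul']
  split_ifs with hkn
  · rw [coeff_qSum]
    exact finsum_mem_congr (Set.ext fun i => by grind) fun _ _ => rfl
  · refine (finsum_mem_of_eqOn_zero fun i hi => ?_).symm
    have := hs.nonneg i hi.1
    have : (k : ℤ) + e i = n := hi.2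
    omega

theorem expand_qSum {k : ℕ} (hk : k ≠ 0) :
    PowerSeries.expand k hk (qSum s e w) = qSum s (fun i => k * e i) w := by
  ext n
  rw [coeff_qSum]
  by_cases hn : k ∣ n
  · obtain ⟨m, rfl⟩ := hn
    rw [coeff_expand_mul, coeff_qSum]
    exact finsum_mem_congr (Set.ext fun i => by simp [hk]) fun _ _ => rfl
  · rw [coeff_expand_of_not_dvd _ _ _ hn]
    refine (finsum_mem_of_eqOn_zero fun i hi => absurd ?_ hn).symm
    exact Int.natCast_dvd_natCast.mp ⟨e i, hi.2.symm⟩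

end QSum

/-- The derivation `q d/dq` on power series. -/
noncomputable def qDeriv (R : Type*) [CommRing R] : Derivation R R⟦X⟧ R⟦X⟧ :=
  (X : R⟦X⟧) • PowerSeries.derivative R

section QDeriv

variable {ι R S : Type*} [CommRing R] [CommRing S]

theorem coeff_qDeriv (f : R⟦X⟧) (n : ℕ) : coeff n (qDeriv R f) = n * coeff n f := by
  cases n with
  | zero => simp [qDeriv]
  | succ n => simp [qDeriv, coeff_succ_X_mul, coeff_derivative, mul_comm]

theorem qDeriv_X_pow (k : ℕ) : qDeriv R (X ^ k) = (k : R⟦X⟧) * X ^ k := by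
  ext n
  rw [coeff_qDeriv, ← map_natCast (C (R := R)), coeff_C_mul, coeff_X_pow]
  split_ifs with h <;> simp [h]

theorem X_pow_dvd_qDeriv {f : R⟦X⟧} {k : ℕ} (h : X ^ k ∣ f) : X ^ k ∣ qDeriv R f := by
  rw [X_pow_dvd_iff] at h ⊢
  intro n hn
  rw [coeff_qDeriv, h n hn, mul_zero]

theorem map_qDeriv (φ : R →+* S) (f : R⟦X⟧) :
    PowerSeries.map φ (qDeriv R f) = qDeriv S (PowerSeries.map φ f) := by
  ext n
  simp [coeff_qDeriv]

theorem qDeriv_expand {k : ℕ} (hk : k ≠ 0) (f : R⟦X⟧) :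
    qDeriv R (PowerSeries.expand k hk f) = (k : R⟦X⟧) * PowerSeries.expand k hk (qDeriv R f) := by
  ext n
  rw [coeff_qDeriv, ← map_natCast (C (R := R)), coeff_C_mul]
  by_cases hn : k ∣ n
  · obtain ⟨m, rfl⟩ := hn
    rw [coeff_expand_mul, coeff_expand_mul, coeff_qDeriv]
    push_cast
    ring
  · rw [coeff_expand_of_not_dvd _ _ _ hn, coeff_expand_of_not_dvd _ _ _ hn, mul_zero, mul_zero]

theorem qDeriv_qSum {s : Set ι} {e : ι → ℤ} {w : ι → R} (hs : QSummable s e) :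
    qDeriv R (qSum s e w) = qSum s e fun i => (e i : R) * w i := by
  ext n
  rw [coeff_qDeriv, coeff_qSum, coeff_qSum, mul_finsum_mem' _ _ (hs.finite_eq n)]
  refine finsum_mem_congr rfl fun i hi => ?_
  rw [hi.2, Int.cast_natCast]

theorem eq_of_forall_X_pow_dvd_sub {f g : R⟦X⟧} (h : ∀ N : ℕ, X ^ (N + 1) ∣ f - g) : f = g := by
  ext n
  have := X_pow_dvd_iff.mp (h n) n (Nat.lt_succ_self n)
  rwa [map_sub, sub_eq_zero] at this

end QDeriv

/-! ### Theta series, rank series and heat equations -/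

/-- The sign `(-1) ^ t` for an integer `t`. -/
def intSign (t : ℤ) : ℤ := (Int.negOnePow t : ℤˣ)

theorem intSign_add (a b : ℤ) : intSign (a + b) = intSign a * intSign b := by
  simp [intSign, Int.negOnePow_add]

theorem intSign_neg (a : ℤ) : intSign (-a) = intSign a := by
  simp [intSign, Int.negOnePow_neg]

/-- The pairs of positive integers, as a set of integer pairs. -/
def posPairs : Set (ℤ × ℤ) := {x | 1 ≤ x.1 ∧ 1 ≤ x.2}

/-- The theta series `∑ (-1)^t t^j q^(t^2)` over all integers `t`. -/
noncomputable def thetaMoment (j : ℕ) : ℤ⟦X⟧ :=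
  qSum Set.univ (fun t : ℤ => t ^ 2) fun t => intSign t * t ^ j

/-- The theta series `∑ (-1)^t q^(t^2)` over all integers `t`. -/
noncomputable def theta : ℤ⟦X⟧ := thetaMoment 0

/-- The series `∑ p (a, b) q^(d a b)` over positive integers `a`, `b`. -/
noncomputable def lambert (d : ℤ) (p : ℤ × ℤ → ℤ) : ℤ⟦X⟧ :=
  qSum posPairs (fun x => d * (x.1 * x.2)) p

/-- The series `∑ σ_k(n) q^(d n)`. -/
noncomputable def sigmaSeries (k : ℕ) (d : ℤ) : ℤ⟦X⟧ := lambert d fun x => x.1 ^ k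

/-- The indefinite theta series `∑ (-1)^a m^k q^(a^2 + 2 a m)` over positive integers `a`, `m`. -/
noncomputable def rankSeries (k : ℕ) : ℤ⟦X⟧ :=
  qSum posPairs (fun x => x.1 ^ 2 + 2 * (x.1 * x.2)) fun x => intSign x.1 * x.2 ^ k

theorem qSummable_sq (s : Set ℤ) : QSummable s fun t : ℤ => t ^ 2 := by
  refine ⟨fun t _ => sq_nonneg t, fun N => (Set.finite_Icc (-N) N).subset fun t ht => ?_⟩
  have := ht.2
  constructor <;> nlinarith

theorem qSummable_posPairs {e : ℤ × ℤ → ℤ} (he : ∀ x ∈ posPairs, x.1 ≤ e x ∧ x.2 ≤ e x) :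
    QSummable posPairs e := by
  refine ⟨fun x hx => by linarith [hx.1, (he x hx).1], fun N => ?_⟩
  refine ((Set.finite_Icc 1 N).prod (Set.finite_Icc 1 N)).subset fun x hx => ?_
  exact ⟨⟨hx.1.1, (he x hx.1).1.trans hx.2⟩, ⟨hx.1.2, (he x hx.1).2.trans hx.2⟩⟩

theorem le_mul_mul_of_mem_posPairs {d : ℤ} (hd : 1 ≤ d) {x : ℤ × ℤ} (hx : x ∈ posPairs) :
    x.1 ≤ d * (x.1 * x.2) ∧ x.2 ≤ d * (x.1 * x.2) := by
  obtain ⟨h1, h2⟩ := hx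
  have : x.1 * x.2 ≤ d * (x.1 * x.2) := le_mul_of_one_le_left (by positivity) hd
  constructor <;> nlinarith

theorem qSummable_lambert {d : ℤ} (hd : 1 ≤ d) :
    QSummable posPairs fun x : ℤ × ℤ => d * (x.1 * x.2) :=
  qSummable_posPairs fun _ => le_mul_mul_of_mem_posPairs hd

theorem qSummable_rankSeries : QSummable posPairs fun x : ℤ × ℤ => x.1 ^ 2 + 2 * (x.1 * x.2) :=
  qSummable_posPairs fun x ⟨_, _⟩ => by constructor <;> nlinarith

theorem qDeriv_thetaMoment (j : ℕ) : qDeriv ℤ (thetaMoment j) = thetaMoment (j + 2) := by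
  rw [thetaMoment, qDeriv_qSum (qSummable_sq _)]
  exact qSum_congr_coeff fun t _ => by push_cast; ring

theorem thetaMoment_odd {j : ℕ} (hj : Odd j) : thetaMoment j = 0 :=
  qSum_eq_zero_of_antisymm (Equiv.neg ℤ) (by simp) (by simp)
    fun t _ => by simp [intSign_neg, hj.neg_pow]

theorem lambert_add {d : ℤ} (hd : 1 ≤ d) (p r : ℤ × ℤ → ℤ) :
    lambert d (fun x => p x + r x) = lambert d p + lambert d r :=
  qSum_add (qSummable_lambert hd)

theorem lambert_const_mul {d : ℤ} (hd : 1 ≤ d) (c : ℤ) (p : ℤ × ℤ → ℤ) :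
    lambert d (fun x => c * p x) = C c * lambert d p :=
  qSum_const_mul (qSummable_lambert hd) c

theorem lambert_swap (d : ℤ) (p : ℤ × ℤ → ℤ) : lambert d (fun x => p x.swap) = lambert d p :=
  qSum_reindex (Equiv.prodComm ℤ ℤ) (fun _ => and_comm) (fun x _ => by simp [mul_comm])
    fun _ _ => rfl

theorem qDeriv_lambert {d : ℤ} (hd : 1 ≤ d) (p : ℤ × ℤ → ℤ) :
    qDeriv ℤ (lambert d p) = C d * lambert d (fun x => x.1 * x.2 * p x) := by
  rw [← lambert_const_mul hd, lambert, qDeriv_qSum (qSummable_lambert hd)]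
  exact qSum_congr_coeff fun x _ => by push_cast; ring

theorem lambert_add_swap {d : ℤ} (hd : 1 ≤ d) (p : ℤ × ℤ → ℤ) :
    lambert d (fun x => p x + p x.swap) = C 2 * lambert d p := by
  rw [lambert_add hd, lambert_swap, map_ofNat]
  ring

theorem qDeriv_sigmaSeries {d : ℤ} (hd : 1 ≤ d) (k : ℕ) :
    qDeriv ℤ (sigmaSeries k d) = C d * lambert d fun x => x.1 ^ (k + 1) * x.2 := by
  rw [sigmaSeries, qDeriv_lambert hd]
  congr! 3 with x
  ring

theorem lambert_linear_sum {d : ℤ} (hd : 1 ≤ d) :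
    lambert d (fun x => x.1 + x.2) = C 2 * sigmaSeries 1 d := by
  rw [sigmaSeries, ← lambert_add_swap hd]
  congr! 2 with x
  simp

theorem lambert_cubic_sum :
    lambert 2 (fun x => (x.1 + x.2) * (x.2 - x.1) ^ 2) =
      2 * sigmaSeries 3 2 - qDeriv ℤ (sigmaSeries 1 2) := by
  have hd : (1 : ℤ) ≤ 2 := one_le_two
  rw [eq_sub_iff_add_eq, qDeriv_sigmaSeries hd, sigmaSeries, ← map_ofNat (C (R := ℤ)) 2]
  simp only [← lambert_add_swap hd, ← lambert_add hd, Prod.fst_swap, Prod.snd_swap]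
  congr! 2 with x
  ring

theorem lambert_quintic_sum :
    lambert 2 (fun x => (x.1 + x.2) * (x.2 - x.1) ^ 4) =
      2 * sigmaSeries 5 2 - 3 * qDeriv ℤ (sigmaSeries 3 2)
        + qDeriv ℤ (qDeriv ℤ (sigmaSeries 1 2)) := by
  have hd : (1 : ℤ) ≤ 2 := one_le_two
  rw [← add_sub_right_comm, eq_sub_iff_add_eq, qDeriv_sigmaSeries hd, qDeriv_sigmaSeries hd,
    ← lambert_const_mul hd 2 fun x => x.1 ^ (1 + 1) * x.2, qDeriv_lambert hd, sigmaSeries,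
    ← map_ofNat (C (R := ℤ)) 2, ← map_ofNat (C (R := ℤ)) 3]
  simp only [← lambert_add_swap hd]
  simp only [← lambert_const_mul hd, ← lambert_add hd, Prod.fst_swap, Prod.snd_swap]
  congr! 2 with x
  ring

/-- The substitution `k = t - a`, `m = t - a + b` carries the exponent `t^2 + 2ab` to
`k^2 + a^2 + 2am`. -/
def shearEquiv : ℤ × ℤ × ℤ ≃ ℤ × ℤ × ℤ where
  toFun x := (x.1 - x.2.1, x.2.1, x.1 - x.2.1 + x.2.2)
  invFun x := (x.1 + x.2.1, x.2.1, x.2.2 - x.1)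
  left_inv x := by ext <;> simp
  right_inv x := by ext <;> simp

/-- The involution of the triples `(k, a, m)` exchanging `k` and `a + m`. -/
def exchangeEquiv : ℤ × ℤ × ℤ ≃ ℤ × ℤ × ℤ where
  toFun x := (x.2.1 + x.2.2, x.1 - x.2.2, x.2.2)
  invFun x := (x.2.1 + x.2.2, x.1 - x.2.2, x.2.2)
  left_inv x := by ext <;> simp
  right_inv x := by ext <;> simp

/-- The involution `(t, a, b) ↦ (-t, b, a)`. -/
def reflectEquiv : ℤ × ℤ × ℤ ≃ ℤ × ℤ × ℤ where
  toFun x := (-x.1, x.2.2, x.2.1)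
  invFun x := (-x.1, x.2.2, x.2.1)
  left_inv x := by ext <;> simp
  right_inv x := by ext <;> simp

/-- The heat operator applied to the rank series, cleared of its theta denominator. -/
noncomputable def heatSeries (k : ℕ) : ℤ⟦X⟧ :=
  theta * qDeriv ℤ (rankSeries k) + theta * rankSeries (k + 2) - qDeriv ℤ theta * rankSeries k

/-- The exponent `k^2 + a^2 + 2am` of the triple `(k, a, m)` in the product of a theta series and a
rank series. -/
def heatExponent (x : ℤ × ℤ × ℤ) : ℤ := x.1 ^ 2 + (x.2.1 ^ 2 + 2 * (x.2.1 * x.2.2))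

/-- The weight of the triple `(k, a, m)` in `heatSeries j`. -/
def heatWeight (j : ℕ) (x : ℤ × ℤ × ℤ) : ℤ :=
  intSign (x.1 + x.2.1) * ((x.2.1 + x.2.2) ^ 2 - x.1 ^ 2) * x.2.2 ^ j

theorem qSummable_heat : QSummable (Set.univ ×ˢ posPairs) heatExponent :=
  (qSummable_sq _).prod qSummable_rankSeries

theorem heatSeries_eq_qSum (j : ℕ) :
    heatSeries j = qSum (Set.univ ×ˢ posPairs) heatExponent (heatWeight j) := by
  have hmul (i : ℕ) (v : ℤ × ℤ → ℤ) :
      thetaMoment i * qSum posPairs (fun x => x.1 ^ 2 + 2 * (x.1 * x.2)) v =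
        qSum (Set.univ ×ˢ posPairs) heatExponent fun x => intSign x.1 * x.1 ^ i * v x.2 :=
    qSum_mul (qSummable_sq _) qSummable_rankSeries
  rw [heatSeries, sub_eq_iff_eq_add, theta, qDeriv_thetaMoment, rankSeries, rankSeries,
    qDeriv_qSum qSummable_rankSeries, hmul, hmul, hmul, ← qSum_add qSummable_heat,
    ← qSum_add qSummable_heat]
  refine qSum_congr_coeff fun x _ => ?_
  rw [heatWeight, intSign_add]
  push_cast
  ring

theorem qSum_heat_exchange (j : ℕ) :
    qSum (Set.univ ×ˢ posPairs \ {x | x.1 ≤ x.2.2}) heatExponent (heatWeight j) = 0 := by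
  refine qSum_eq_zero_of_antisymm exchangeEquiv (fun x => ?_) (fun x _ => ?_) fun x _ => ?_
  · simp only [exchangeEquiv, posPairs, Equiv.coe_fn_mk, Set.mem_sdiff, Set.mem_prod,
      Set.mem_univ, Set.mem_ofPred_eq, true_and]
    omega
  · simp only [exchangeEquiv, heatExponent, Equiv.coe_fn_mk]
    ring
  · simp only [exchangeEquiv, heatWeight, Equiv.coe_fn_mk]
    rw [show x.2.1 + x.2.2 + (x.1 - x.2.2) = x.1 + x.2.1 by ring]
    ring

/-- The exponent of the ternary sum in the coordinates `(t, a, b)`. -/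
def shearExponent (x : ℤ × ℤ × ℤ) : ℤ := x.1 ^ 2 + 2 * (x.2.1 * x.2.2)

/-- The weight of the ternary sum in the coordinates `(t, a, b)`. -/
def shearWeight (j : ℕ) (x : ℤ × ℤ × ℤ) : ℤ :=
  intSign x.1 * ((x.1 + x.2.2) ^ 2 - (x.1 - x.2.1) ^ 2) * (x.1 - x.2.1 + x.2.2) ^ j

/-- The ternary sum in the coordinates `(t, a, b)`, over a region `s`. -/
noncomputable def shearSum (j : ℕ) (s : Set (ℤ × ℤ × ℤ)) : ℤ⟦X⟧ :=
  qSum s shearExponent (shearWeight j)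

/-- The image of the region `1 ≤ a`, `1 ≤ m`, `k ≤ m` in the coordinates `(t, a, b)`. -/
def shearRegion : Set (ℤ × ℤ × ℤ) := {x | 1 ≤ x.2.1 ∧ 0 ≤ x.2.2 ∧ 1 ≤ x.1 - x.2.1 + x.2.2}

theorem heatExponent_shearEquiv (x : ℤ × ℤ × ℤ) :
    heatExponent (shearEquiv x) = shearExponent x := by
  simp only [shearEquiv, heatExponent, shearExponent, Equiv.coe_fn_mk]
  ring

theorem heatWeight_shearEquiv (j : ℕ) (x : ℤ × ℤ × ℤ) :
    heatWeight j (shearEquiv x) = shearWeight j x := by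
  simp only [shearEquiv, heatWeight, shearWeight, Equiv.coe_fn_mk, sub_add_cancel]
  ring

theorem qSummable_shearRegion : QSummable shearRegion shearExponent :=
  qSummable_heat.preimage shearEquiv (fun _ hx => ⟨trivial, hx.1, hx.2.2⟩)
    fun x _ => (heatExponent_shearEquiv x).symm

theorem heatSeries_eq_shearSum (j : ℕ) : heatSeries j = shearSum j shearRegion := by
  rw [heatSeries_eq_qSum, ← qSum_inter_add_sdiff qSummable_heat {x | x.1 ≤ x.2.2},
    qSum_heat_exchange, add_zero]
  refine (qSum_reindex shearEquiv (fun x => ?_) (fun x _ => heatExponent_shearEquiv x)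
    fun x _ => heatWeight_shearEquiv j x).symm
  simp only [shearEquiv, shearRegion, posPairs, Equiv.coe_fn_mk, Set.mem_inter_iff, Set.mem_prod,
    Set.mem_univ, Set.mem_ofPred_eq, true_and]
  omega

theorem qSummable_shear : QSummable (Set.univ ×ˢ posPairs) shearExponent :=
  (qSummable_sq _).prod (qSummable_lambert one_le_two)

/-- For odd `j` the reflection `(t, a, b) ↦ (-t, b, a)` preserves the summand and changes the sign
of `t - a + b`. -/
theorem two_mul_shearSum_interior {j : ℕ} (hj : Odd j) :
    2 * shearSum j (shearRegion ∩ {x | 1 ≤ x.2.2}) = shearSum j (Set.univ ×ˢ posPairs) := by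
  let P : Set (ℤ × ℤ × ℤ) := {x | 1 ≤ x.1 - x.2.1 + x.2.2}
  have hregion : shearRegion ∩ {x | 1 ≤ x.2.2} = Set.univ ×ˢ posPairs ∩ P := by
    ext x
    simp only [shearRegion, posPairs, P, Set.mem_inter_iff, Set.mem_prod, Set.mem_univ,
      Set.mem_ofPred_eq, true_and]
    omega
  have hzero : shearSum j (Set.univ ×ˢ posPairs \ P) =
      shearSum j (Set.univ ×ˢ posPairs ∩ {x | 1 ≤ -(x.1 - x.2.1 + x.2.2)}) := by
    refine qSum_of_subset (fun x hx => ⟨hx.1, fun h => ?_⟩) fun x hx hxs => ?_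
    · have h1 : 1 ≤ x.1 - x.2.1 + x.2.2 := h
      have h2 : 1 ≤ -(x.1 - x.2.1 + x.2.2) := hx.2
      omega
    · have h1 : ¬1 ≤ x.1 - x.2.1 + x.2.2 := hx.2
      have h2 : ¬1 ≤ -(x.1 - x.2.1 + x.2.2) := fun h => hxs ⟨hx.1, h⟩
      rw [shearWeight, show x.1 - x.2.1 + x.2.2 = 0 by omega, zero_pow hj.pos.ne', mul_zero]
  have hreflect : shearSum j (Set.univ ×ˢ posPairs ∩ {x | 1 ≤ -(x.1 - x.2.1 + x.2.2)}) =
      shearSum j (Set.univ ×ˢ posPairs ∩ P) := by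
    refine qSum_reindex reflectEquiv (fun x => ?_) (fun x _ => ?_) fun x _ => ?_
    · simp only [reflectEquiv, posPairs, P, Equiv.coe_fn_mk, Set.mem_inter_iff, Set.mem_prod,
        Set.mem_univ, Set.mem_ofPred_eq, true_and]
      omega
    · simp only [reflectEquiv, shearExponent, Equiv.coe_fn_mk]
      ring
    · simp only [reflectEquiv, shearWeight, Equiv.coe_fn_mk, intSign_neg]
      rw [show -x.1 - x.2.2 + x.2.1 = -(x.1 - x.2.1 + x.2.2) by ring, hj.neg_pow]
      ring
  have hsplit : shearSum j (Set.univ ×ˢ posPairs ∩ P) + shearSum j (Set.univ ×ˢ posPairs \ P) =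
      shearSum j (Set.univ ×ˢ posPairs) := qSum_inter_add_sdiff qSummable_shear P
  rw [hregion, ← hsplit, hzero, hreflect, two_mul]

theorem thetaMoment_mul_lambert (j : ℕ) (p : ℤ × ℤ → ℤ) :
    thetaMoment j * lambert 2 p =
      qSum (Set.univ ×ˢ posPairs) shearExponent fun x => intSign x.1 * x.1 ^ j * p x.2 :=
  qSum_mul (qSummable_sq _) (qSummable_lambert one_le_two)

theorem shearSum_one_posPairs :
    shearSum 1 (Set.univ ×ˢ posPairs) =
      4 * qDeriv ℤ theta * sigmaSeries 1 2
        + theta * (2 * sigmaSeries 3 2 - qDeriv ℤ (sigmaSeries 1 2)) := by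
  have hexpand : shearSum 1 (Set.univ ×ˢ posPairs) =
      C 2 * (thetaMoment 2 * lambert 2 (fun x => x.1 + x.2)) +
      C 3 * (thetaMoment 1 * lambert 2 (fun x => (x.1 + x.2) * (x.2 - x.1))) +
      thetaMoment 0 * lambert 2 (fun x => (x.1 + x.2) * (x.2 - x.1) ^ 2) := by
    simp only [thetaMoment_mul_lambert, ← qSum_const_mul qSummable_shear,
      ← qSum_add qSummable_shear]
    exact qSum_congr_coeff fun x _ => by rw [shearWeight]; ring
  rw [hexpand, thetaMoment_odd (j := 1) (by decide), lambert_linear_sum one_le_two,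
    lambert_cubic_sum, theta, qDeriv_thetaMoment, map_ofNat]
  ring

theorem shearSum_three_posPairs :
    shearSum 3 (Set.univ ×ˢ posPairs) =
      4 * qDeriv ℤ (qDeriv ℤ theta) * sigmaSeries 1 2
        + 9 * qDeriv ℤ theta * (2 * sigmaSeries 3 2 - qDeriv ℤ (sigmaSeries 1 2))
        + theta * (2 * sigmaSeries 5 2 - 3 * qDeriv ℤ (sigmaSeries 3 2)
          + qDeriv ℤ (qDeriv ℤ (sigmaSeries 1 2))) := by
  have hexpand : shearSum 3 (Set.univ ×ˢ posPairs) =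
      C 2 * (thetaMoment 4 * lambert 2 (fun x => x.1 + x.2)) +
      C 9 * (thetaMoment 2 * lambert 2 (fun x => (x.1 + x.2) * (x.2 - x.1) ^ 2)) +
      thetaMoment 0 * lambert 2 (fun x => (x.1 + x.2) * (x.2 - x.1) ^ 4) +
      C 7 * (thetaMoment 3 * lambert 2 (fun x => (x.1 + x.2) * (x.2 - x.1))) +
      C 5 * (thetaMoment 1 * lambert 2 (fun x => (x.1 + x.2) * (x.2 - x.1) ^ 3)) := by
    simp only [thetaMoment_mul_lambert, ← qSum_const_mul qSummable_shear,
      ← qSum_add qSummable_shear]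
    exact qSum_congr_coeff fun x _ => by rw [shearWeight]; ring
  rw [hexpand, thetaMoment_odd (j := 1) (by decide), thetaMoment_odd (j := 3) (by decide),
    lambert_linear_sum one_le_two, lambert_cubic_sum, lambert_quintic_sum, theta,
    qDeriv_thetaMoment, qDeriv_thetaMoment, map_ofNat, map_ofNat]
  ring

theorem shearSum_boundary (j : ℕ) :
    shearSum j (shearRegion \ {x | 1 ≤ x.2.2}) =
      qSum {t | 1 ≤ t} (fun t => t ^ 2) fun t =>
        intSign t * ∑ m ∈ Finset.Ico 1 t, (t ^ 2 - m ^ 2) * m ^ j := by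
  have hb : ∀ x ∈ shearRegion \ {x | 1 ≤ x.2.2}, x.2.2 = 0 :=
    fun x hx => le_antisymm (not_lt.mp hx.2) hx.1.2.1
  rw [shearSum, qSum_fiber (qSummable_shearRegion.mono Set.sdiff_subset) Prod.fst
    (fun t => (Finset.Ico 1 t).image fun m => (t, t - m, 0)) (u := {t | 1 ≤ t})
    (f := fun t => t ^ 2)]
  · refine qSum_congr_coeff fun t _ => ?_
    rw [Finset.sum_image (by simp [Set.InjOn]), Finset.mul_sum]
    exact Finset.sum_congr rfl fun m _ => by rw [shearWeight]; ring
  · rintro t - ⟨t', a, b⟩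
    simp only [Finset.mem_image, Finset.mem_Ico, Prod.mk.injEq, shearRegion, Set.mem_sdiff,
      Set.mem_ofPred_eq]
    exact ⟨by rintro ⟨m, hm, rfl, rfl, rfl⟩; omega, fun h => ⟨t - a, by omega⟩⟩
  · intro x hx
    have := hb x hx
    have := hx.1.1
    have := hx.1.2.2
    change 1 ≤ x.1
    omega
  · intro x hx
    rw [shearExponent, hb x hx]
    ring

theorem qSum_sq_eq_two_mul {P : ℤ → ℤ} (hP : ∀ t, P (-t) = P t) (h0 : P 0 = 0) :
    qSum Set.univ (fun t : ℤ => t ^ 2) P = 2 * qSum {t | 1 ≤ t} (fun t => t ^ 2) P := by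
  have hneg : qSum (Set.univ \ {t | 1 ≤ t}) (fun t : ℤ => t ^ 2) P =
      qSum {t | 1 ≤ t} (fun t => t ^ 2) P := by
    have hzero : qSum (Set.univ \ {t | 1 ≤ t}) (fun t : ℤ => t ^ 2) P =
        qSum {t | 1 ≤ -t} (fun t => t ^ 2) P := by
      refine qSum_of_subset (fun t ht => ⟨trivial, fun h => ?_⟩) fun t ht hts => ?_
      · have h1 : 1 ≤ t := h
        have h2 : 1 ≤ -t := ht
        omega
      · have h1 : ¬1 ≤ t := ht.2
        have h2 : ¬1 ≤ -t := hts
        rw [show t = 0 by omega, h0]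
    rw [hzero]
    exact qSum_reindex (Equiv.neg ℤ) (fun _ => Iff.rfl) (fun t _ => by simp) fun t _ => hP t
  rw [← qSum_inter_add_sdiff (qSummable_sq _) {t | 1 ≤ t}, hneg, Set.univ_inter, two_mul]

theorem mul_sum_Ico_eq {c : ℤ} {f G : ℤ → ℤ} (h1 : G 1 = 0)
    (hG : ∀ n, G (n + 1) = G n + c * f n) {t : ℤ} (ht : 1 ≤ t) :
    c * ∑ m ∈ Finset.Ico 1 t, f m = G t := by
  induction t, ht using Int.leInduction with
  | base => simp [h1]
  | succ n hn ih =>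
    rw [← Finset.insert_Ico_right_eq_Ico_add_one hn, Finset.sum_insert (by simp), mul_add, ih, hG,
      add_comm]

theorem two_mul_shearSum_boundary {j : ℕ} (c : ℤ) {P : ℤ → ℤ} (hP : ∀ t, P (-t) = P t)
    (h0 : P 0 = 0)
    (hsum : ∀ t : ℤ, 1 ≤ t → c * ∑ m ∈ Finset.Ico 1 t, (t ^ 2 - m ^ 2) * m ^ j = P t) :
    2 * (C c * shearSum j (shearRegion \ {x | 1 ≤ x.2.2})) =
      qSum Set.univ (fun t : ℤ => t ^ 2) fun t => intSign t * P t := by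
  rw [shearSum_boundary, qSum_sq_eq_two_mul (fun t => by rw [intSign_neg, hP])
    (by rw [h0, mul_zero]), ← qSum_const_mul (qSummable_sq _)]
  congr 1
  exact qSum_congr_coeff fun t ht => by rw [← hsum t ht]; ring

theorem eight_mul_shearSum_one_boundary :
    8 * shearSum 1 (shearRegion \ {x | 1 ≤ x.2.2}) =
      qDeriv ℤ (qDeriv ℤ theta) - qDeriv ℤ theta := by
  have h := two_mul_shearSum_boundary (j := 1) 4 (P := fun t => t ^ 4 - t ^ 2)
    (fun t => by ring) (by norm_num) fun t ht => by
      rw [mul_sum_Ico_eq (G := fun n => 2 * t ^ 2 * (n - 1) * n - (n - 1) ^ 2 * n ^ 2)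
        (by norm_num) (fun n => by ring) ht]
      ring
  have hmoment : qSum Set.univ (fun t : ℤ => t ^ 2) (fun t => intSign t * (t ^ 4 - t ^ 2)) =
      qDeriv ℤ (qDeriv ℤ theta) - qDeriv ℤ theta := by
    rw [eq_sub_iff_add_eq, theta, qDeriv_thetaMoment, qDeriv_thetaMoment, thetaMoment, thetaMoment,
      ← qSum_add (qSummable_sq _)]
    exact qSum_congr_coeff fun t _ => by ring
  rw [← hmoment, ← h, map_ofNat]
  ring

theorem twenty_four_mul_shearSum_three_boundary :
    24 * shearSum 3 (shearRegion \ {x | 1 ≤ x.2.2}) =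
      qDeriv ℤ (qDeriv ℤ (qDeriv ℤ theta)) - 2 * qDeriv ℤ (qDeriv ℤ theta) + qDeriv ℤ theta := by
  have h := two_mul_shearSum_boundary (j := 3) 12 (P := fun t => t ^ 6 - 2 * t ^ 4 + t ^ 2)
    (fun t => by ring) (by norm_num) fun t ht => by
      rw [mul_sum_Ico_eq (G := fun n => 3 * t ^ 2 * ((n - 1) ^ 2 * n ^ 2) -
        (n - 1) ^ 2 * n ^ 2 * (2 * n ^ 2 - 2 * n - 1)) (by norm_num) (fun n => by ring) ht]
      ring
  have hmoment :
      qSum Set.univ (fun t : ℤ => t ^ 2) (fun t => intSign t * (t ^ 6 - 2 * t ^ 4 + t ^ 2)) =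
        qDeriv ℤ (qDeriv ℤ (qDeriv ℤ theta)) - 2 * qDeriv ℤ (qDeriv ℤ theta) + qDeriv ℤ theta := by
    rw [← add_sub_right_comm, eq_sub_iff_add_eq, theta, qDeriv_thetaMoment, qDeriv_thetaMoment,
      qDeriv_thetaMoment, thetaMoment, thetaMoment, thetaMoment, ← map_ofNat (C (R := ℤ)) 2]
    simp only [← qSum_const_mul (qSummable_sq _), ← qSum_add (qSummable_sq _)]
    exact qSum_congr_coeff fun t _ => by ring
  rw [← hmoment, ← h, map_ofNat]
  ring

theorem heatSeries_eq_interior_add_boundary (j : ℕ) :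
    heatSeries j = shearSum j (shearRegion ∩ {x | 1 ≤ x.2.2}) +
      shearSum j (shearRegion \ {x | 1 ≤ x.2.2}) := by
  rw [heatSeries_eq_shearSum]
  exact (qSum_inter_add_sdiff qSummable_shearRegion _).symm

theorem eight_mul_heatSeries_one :
    8 * heatSeries 1 = 16 * qDeriv ℤ theta * sigmaSeries 1 2 + 8 * theta * sigmaSeries 3 2
      - 4 * theta * qDeriv ℤ (sigmaSeries 1 2)
      + qDeriv ℤ (qDeriv ℤ theta) - qDeriv ℤ theta := by
  have hinterior := two_mul_shearSum_interior (j := 1) (by decide)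
  rw [shearSum_one_posPairs] at hinterior
  rw [heatSeries_eq_interior_add_boundary]
  linear_combination 4 * hinterior + eight_mul_shearSum_one_boundary

theorem twenty_four_mul_heatSeries_three :
    24 * heatSeries 3 = 48 * qDeriv ℤ (qDeriv ℤ theta) * sigmaSeries 1 2
      + 216 * qDeriv ℤ theta * sigmaSeries 3 2
      - 108 * qDeriv ℤ theta * qDeriv ℤ (sigmaSeries 1 2)
      + 24 * theta * sigmaSeries 5 2 - 36 * theta * qDeriv ℤ (sigmaSeries 3 2)
      + 12 * theta * qDeriv ℤ (qDeriv ℤ (sigmaSeries 1 2))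
      + qDeriv ℤ (qDeriv ℤ (qDeriv ℤ theta)) - 2 * qDeriv ℤ (qDeriv ℤ theta)
      + qDeriv ℤ theta := by
  have hinterior := two_mul_shearSum_interior (j := 3) (by decide)
  rw [shearSum_three_posPairs] at hinterior
  rw [heatSeries_eq_interior_add_boundary]
  linear_combination 12 * hinterior + twenty_four_mul_shearSum_three_boundary

/-! ### Convolutions of divisor sums -/

/-- The series `∑ f q^(ax + by)` over the quadruples `((a, x), (b, y))` of positive integers in a
region `s`. -/
noncomputable def quadSum (s : Set ((ℤ × ℤ) × ℤ × ℤ)) (f : (ℤ × ℤ) × ℤ × ℤ → ℤ) : ℤ⟦X⟧ :=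
  qSum (posPairs ×ˢ posPairs ∩ s) (fun z => 1 * (z.1.1 * z.1.2) + 1 * (z.2.1 * z.2.2)) f

theorem qSummable_quadSum (s : Set ((ℤ × ℤ) × ℤ × ℤ)) :
    QSummable (posPairs ×ˢ posPairs ∩ s)
      fun z => 1 * (z.1.1 * z.1.2) + 1 * (z.2.1 * z.2.2) :=
  ((qSummable_lambert le_rfl).prod (qSummable_lambert le_rfl)).mono Set.inter_subset_left

section QuadSum

variable (s : Set ((ℤ × ℤ) × ℤ × ℤ)) (f : (ℤ × ℤ) × ℤ × ℤ → ℤ)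

theorem quadSum_swap : quadSum (Prod.swap ⁻¹' s) (fun z => f z.swap) = quadSum s f :=
  qSum_reindex (Equiv.prodComm (ℤ × ℤ) (ℤ × ℤ)) (fun _ => and_congr_left' and_comm)
    (fun _ _ => add_comm _ _) fun _ _ => rfl

theorem quadSum_swap_swap :
    quadSum {z | (z.1.swap, z.2.swap) ∈ s} (fun z => f (z.1.swap, z.2.swap)) = quadSum s f :=
  qSum_reindex ((Equiv.prodComm ℤ ℤ).prodCongr (Equiv.prodComm ℤ ℤ))
    (fun _ => and_congr_left' (and_congr and_comm and_comm))
    (fun z _ => by simp [mul_comm]) fun _ _ => rfl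

/-- The substitution `(a, x, b, y) ↦ (a, x - y, a + b, y)`. -/
def quadEquiv : (ℤ × ℤ) × ℤ × ℤ ≃ (ℤ × ℤ) × ℤ × ℤ where
  toFun z := ((z.1.1, z.1.2 - z.2.2), (z.1.1 + z.2.1, z.2.2))
  invFun z := ((z.1.1, z.1.2 + z.2.2), (z.2.1 - z.1.1, z.2.2))
  left_inv z := by ext <;> simp
  right_inv z := by ext <;> simp

theorem quadSum_shift :
    quadSum {z | z.2.2 < z.1.2} (fun z => f (quadEquiv z)) = quadSum {z | z.1.1 < z.2.1} f := by
  refine qSum_reindex quadEquiv (fun z => ?_) (fun z _ => ?_) fun _ _ => rfl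
  · simp only [quadEquiv, posPairs, Equiv.coe_fn_mk, Set.mem_inter_iff, Set.mem_prod,
      Set.mem_ofPred_eq]
    omega
  · simp only [quadEquiv, Equiv.coe_fn_mk]
    ring

theorem quadSum_trichotomy (u v : (ℤ × ℤ) × ℤ × ℤ → ℤ) :
    quadSum Set.univ f =
      quadSum {z | u z < v z} f + quadSum {z | v z < u z} f + quadSum {z | u z = v z} f := by
  have hlt := qSum_inter_add_sdiff (w := f) (qSummable_quadSum Set.univ) {z | u z < v z}
  have hgt := qSum_inter_add_sdiff (w := f)
    ((qSummable_quadSum Set.univ).mono (Set.sdiff_subset (t := {z | u z < v z}))) {z | v z < u z}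
  have hset_gt : (posPairs ×ˢ posPairs ∩ Set.univ) \ {z | u z < v z} ∩ {z | v z < u z} =
      posPairs ×ˢ posPairs ∩ {z | v z < u z} := by
    ext z
    exact ⟨fun h => ⟨h.1.1.1, h.2⟩,
      fun h => ⟨⟨⟨h.1, trivial⟩, fun (h' : u z < v z) => lt_asymm h.2 h'⟩, h.2⟩⟩
  have hset_eq : ((posPairs ×ˢ posPairs ∩ Set.univ) \ {z | u z < v z}) \ {z | v z < u z} =
      posPairs ×ˢ posPairs ∩ {z | u z = v z} := by
    ext z
    exact ⟨fun h => ⟨h.1.1.1, le_antisymm (not_lt.mp h.2) (not_lt.mp h.1.2)⟩,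
      fun h => ⟨⟨⟨h.1, trivial⟩, not_lt.mpr (ge_of_eq h.2)⟩, not_lt.mpr (le_of_eq h.2)⟩⟩
  rw [hset_gt, hset_eq] at hgt
  rw [quadSum, ← hlt, ← hgt, ← add_assoc, Set.inter_univ]
  rfl

end QuadSum

theorem quadSum_sum_sq_eq_diff_sq_add :
    quadSum Set.univ (fun z => (z.1.1 + z.2.1) ^ 2) =
      quadSum Set.univ (fun z => (z.1.1 - z.2.1) ^ 2) + 4 * sigmaSeries 1 1 ^ 2 := by
  have hsq : sigmaSeries 1 1 ^ 2 = quadSum Set.univ fun z => z.1.1 * z.2.1 := by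
    rw [sq, sigmaSeries, lambert, qSum_mul (qSummable_lambert le_rfl) (qSummable_lambert le_rfl),
      quadSum, Set.inter_univ]
    simp only [pow_one]
  rw [hsq, ← map_ofNat (C (R := ℤ)) 4]
  simp only [quadSum, ← qSum_const_mul (qSummable_quadSum _), ← qSum_add (qSummable_quadSum _)]
  exact qSum_congr_coeff fun z _ => by ring

theorem quadSum_sum_sq :
    quadSum Set.univ (fun z => (z.1.1 + z.2.1) ^ 2) =
      2 * quadSum {z | z.1.1 < z.2.1} (fun z => z.2.1 ^ 2) +
        quadSum {z | z.1.2 = z.2.2} (fun z => (z.1.1 + z.2.1) ^ 2) := by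
  have hswap : quadSum {z | z.1.2 < z.2.2} (fun z => (z.1.1 + z.2.1) ^ 2) =
      quadSum {z | z.2.2 < z.1.2} (fun z => (z.1.1 + z.2.1) ^ 2) := by
    rw [← quadSum_swap]
    exact qSum_congr_coeff fun z _ => by simp only [Prod.fst_swap, add_comm, Prod.snd_swap]
  have hshift : quadSum {z | z.2.2 < z.1.2} (fun z => (z.1.1 + z.2.1) ^ 2) =
      quadSum {z | z.1.1 < z.2.1} (fun z => z.2.1 ^ 2) := quadSum_shift fun z => z.2.1 ^ 2
  rw [quadSum_trichotomy _ (fun z => z.1.2) fun z => z.2.2, hswap, hshift, two_mul]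

theorem quadSum_diff_sq :
    quadSum Set.univ (fun z => (z.1.1 - z.2.1) ^ 2) =
      2 * quadSum {z | z.2.2 < z.1.2} (fun z => z.2.1 ^ 2) := by
  have hswap : quadSum {z | z.2.1 < z.1.1} (fun z => (z.1.1 - z.2.1) ^ 2) =
      quadSum {z | z.1.1 < z.2.1} (fun z => (z.1.1 - z.2.1) ^ 2) := by
    rw [← quadSum_swap]
    exact qSum_congr_coeff fun z _ => by simp only [Prod.fst_swap, Prod.snd_swap]; ring
  have hshift : quadSum {z | z.1.1 < z.2.1} (fun z => (z.1.1 - z.2.1) ^ 2) =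
      quadSum {z | z.2.2 < z.1.2} (fun z => z.2.1 ^ 2) := by
    rw [← quadSum_shift]
    exact qSum_congr_coeff fun z _ => by simp only [quadEquiv, Equiv.coe_fn_mk]; ring
  have hdiag : quadSum {z | z.1.1 = z.2.1} (fun z => (z.1.1 - z.2.1) ^ 2) = 0 :=
    qSum_eq_zero fun z hz => by rw [show z.1.1 = z.2.1 from hz.2, sub_self, zero_pow two_ne_zero]
  rw [quadSum_trichotomy _ (fun z => z.1.1) fun z => z.2.1, hswap, hshift, hdiag, two_mul, add_zero]

theorem quadSum_sq_lt_sub_lt :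
    quadSum {z | z.1.1 < z.2.1} (fun z => z.2.1 ^ 2) -
        quadSum {z | z.2.2 < z.1.2} (fun z => z.2.1 ^ 2) =
      quadSum {z | z.1.2 = z.2.2} (fun z => z.2.1 ^ 2) -
        quadSum {z | z.1.1 = z.2.1} (fun z => z.2.1 ^ 2) := by
  have hshift : quadSum {z | z.1.2 < z.2.2} (fun z => z.2.1 ^ 2) =
      quadSum {z | z.2.1 < z.1.1} (fun z => z.2.1 ^ 2) := by
    rw [← quadSum_swap, ← quadSum_swap {z | z.2.1 < z.1.1}]
    exact quadSum_shift fun z => z.1.1 ^ 2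
  have hrow := quadSum_trichotomy (fun z => z.2.1 ^ 2) (fun z => z.1.1) fun z => z.2.1
  have hcol := quadSum_trichotomy (fun z => z.2.1 ^ 2) (fun z => z.1.2) fun z => z.2.2
  linear_combination hcol - hrow + hshift

theorem four_mul_sigmaSeries_sq :
    4 * sigmaSeries 1 1 ^ 2 = quadSum {z | z.1.2 = z.2.2} (fun z => (z.1.1 + z.2.1) ^ 2)
      + 2 * quadSum {z | z.1.2 = z.2.2} (fun z => z.2.1 ^ 2)
      - 2 * quadSum {z | z.1.1 = z.2.1} (fun z => z.2.1 ^ 2) := by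
  linear_combination quadSum_sum_sq - quadSum_sum_sq_eq_diff_sq_add - quadSum_diff_sq
    + 2 * quadSum_sq_lt_sub_lt

theorem quadSum_eq_lambert (f : ℤ → ℤ → ℤ → ℤ) :
    quadSum {z | z.1.1 = z.2.1} (fun z => f z.1.1 (z.1.2 + z.2.2) z.2.2) =
      lambert 1 fun x => ∑ y ∈ Finset.Ico 1 x.2, f x.1 x.2 y := by
  rw [quadSum, lambert, qSum_fiber (qSummable_quadSum _) (fun z => (z.1.1, z.1.2 + z.2.2))
    (fun x => (Finset.Ico 1 x.2).image fun y => ((x.1, x.2 - y), (x.1, y)))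
    (u := posPairs) (f := fun x => 1 * (x.1 * x.2))]
  · refine qSum_congr_coeff fun x _ => ?_
    rw [Finset.sum_image (by simp [Set.InjOn])]
    simp only [sub_add_cancel]
  · rintro ⟨a, n⟩ ha ⟨⟨a', x⟩, b, y⟩
    have : 1 ≤ a := ha.1
    simp only [Finset.mem_image, Finset.mem_Ico, Prod.mk.injEq, posPairs, Set.mem_inter_iff,
      Set.mem_prod, Set.mem_ofPred_eq]
    exact ⟨by rintro ⟨y, hy, ⟨rfl, rfl⟩, rfl, rfl⟩; omega, fun h => ⟨y, by omega⟩⟩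
  · intro z hz
    exact ⟨hz.1.1.1, show 1 ≤ z.1.2 + z.2.2 by linarith [hz.1.1.2, hz.1.2.2]⟩
  · intro z hz
    rw [show z.1.1 = z.2.1 from hz.2]
    ring

theorem lambert_congr {d : ℤ} {p r : ℤ × ℤ → ℤ} (h : ∀ x ∈ posPairs, p x = r x) :
    lambert d p = lambert d r :=
  qSum_congr_coeff h

theorem lambert_card_Ico (g : ℤ × ℤ → ℤ) :
    lambert 1 (fun x => ∑ _y ∈ Finset.Ico 1 x.2, g x) = lambert 1 fun x => g x * (x.2 - 1) :=
  lambert_congr fun x hx => by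
    rw [Finset.sum_const, Int.card_Ico, nsmul_eq_mul, Int.toNat_of_nonneg (sub_nonneg.mpr hx.2),
      mul_comm]

theorem quadSum_row_sq :
    quadSum {z | z.1.1 = z.2.1} (fun z => z.2.1 ^ 2) = lambert 1 fun x => x.1 ^ 2 * (x.2 - 1) := by
  rw [← lambert_card_Ico, ← quadSum_eq_lambert fun a _ _ => a ^ 2]
  exact qSum_congr_coeff fun z hz => by rw [show z.1.1 = z.2.1 from hz.2]

theorem quadSum_col_sum_sq :
    quadSum {z | z.1.2 = z.2.2} (fun z => (z.1.1 + z.2.1) ^ 2) =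
      lambert 1 fun x => x.2 ^ 2 * (x.2 - 1) := by
  rw [← lambert_card_Ico, ← quadSum_eq_lambert fun _ n _ => n ^ 2, ← quadSum_swap_swap]
  rfl

theorem six_mul_quadSum_col_sq :
    6 * quadSum {z | z.1.2 = z.2.2} (fun z => z.2.1 ^ 2) =
      lambert 1 fun x => (x.2 - 1) * x.2 * (2 * x.2 - 1) := by
  have hcol : quadSum {z | z.1.2 = z.2.2} (fun z => z.2.1 ^ 2) =
      lambert 1 fun x => ∑ y ∈ Finset.Ico 1 x.2, y ^ 2 := by
    rw [← quadSum_eq_lambert fun _ _ y => y ^ 2, ← quadSum_swap_swap]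
    rfl
  rw [hcol, ← map_ofNat (C (R := ℤ)) 6, ← lambert_const_mul le_rfl]
  exact lambert_congr fun x hx => mul_sum_Ico_eq (f := fun y => y ^ 2)
    (G := fun n => (n - 1) * n * (2 * n - 1)) (by norm_num) (fun n => by ring) hx.2

/-- Ramanujan's convolution identity for the divisor function. -/
theorem twelve_mul_sigmaSeries_sq :
    12 * sigmaSeries 1 1 ^ 2 =
      5 * sigmaSeries 3 1 + sigmaSeries 1 1 - 6 * qDeriv ℤ (sigmaSeries 1 1) := by
  have hcubic : 3 * lambert 1 (fun x => x.2 ^ 2 * (x.2 - 1)) +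
      lambert 1 (fun x => (x.2 - 1) * x.2 * (2 * x.2 - 1)) + 6 * lambert 1 (fun x => x.1 ^ 2) =
      5 * sigmaSeries 3 1 + sigmaSeries 1 1 := by
    rw [← lambert_swap 1 fun x => x.1 ^ 2, sigmaSeries, sigmaSeries,
      ← lambert_swap 1 fun x => x.1 ^ 3, ← lambert_swap 1 fun x => x.1 ^ 1,
      ← map_ofNat (C (R := ℤ)) 3, ← map_ofNat (C (R := ℤ)) 6, ← map_ofNat (C (R := ℤ)) 5]
    simp only [← lambert_const_mul le_rfl, ← lambert_add le_rfl]
    exact lambert_congr fun x _ => by simp only [Prod.fst_swap]; ring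
  have hderiv : lambert 1 (fun x => x.1 ^ 2 * (x.2 - 1)) + lambert 1 (fun x => x.1 ^ 2) =
      qDeriv ℤ (sigmaSeries 1 1) := by
    rw [qDeriv_sigmaSeries le_rfl, map_one, one_mul, ← lambert_add le_rfl]
    exact lambert_congr fun x _ => by ring
  have hliouville := four_mul_sigmaSeries_sq
  rw [quadSum_row_sq, quadSum_col_sum_sq] at hliouville
  linear_combination 3 * hliouville + six_mul_quadSum_col_sq + hcubic - 6 * hderiv

/-! ### Bailey's lemma -/

section QProducts

variable {A : Type*} [CommRing A]

/-- The `q`-Pochhammer symbol `(1 - q) (1 - q^2) ⋯ (1 - q^n)`. -/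
def qPoch (q : A) (n : ℕ) : A := ∏ i ∈ Finset.range n, (1 - q ^ (i + 1))

/-- The finite product `(1 + q) (1 + q^2) ⋯ (1 + q^n)`. -/
def qPochPlus (q : A) (n : ℕ) : A := ∏ i ∈ Finset.range n, (1 + q ^ (i + 1))

theorem qPoch_succ (q : A) (n : ℕ) : qPoch q (n + 1) = qPoch q n * (1 - q ^ (n + 1)) :=
  Finset.prod_range_succ _ _

theorem qPochPlus_succ (q : A) (n : ℕ) :
    qPochPlus q (n + 1) = qPochPlus q n * (1 + q ^ (n + 1)) :=
  Finset.prod_range_succ _ _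

end QProducts

theorem sum_Icc_neg {A : Type*} [AddCommMonoid A] (N : ℕ) (f : ℤ → A) :
    ∑ r ∈ Finset.Icc (-N : ℤ) N, f (-r) = ∑ r ∈ Finset.Icc (-N : ℤ) N, f r :=
  Finset.sum_equiv (Equiv.neg ℤ)
    (fun r => by simp only [Finset.mem_Icc, Equiv.neg_apply]; omega) fun _ _ => rfl

theorem sum_Icc_eq_zero_of_antisymm {A : Type*} [AddCommGroup A] (N : ℕ) (f : ℤ → A)
    (hf : ∀ r, f (-1 - r) = -f r) (hN : f N = 0) : ∑ r ∈ Finset.Icc (-N : ℤ) N, f r = 0 := by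
  rw [← Finset.Ico_insert_right (by omega), Finset.sum_insert (by simp), hN, zero_add]
  refine Finset.sum_involution (fun r _ => -1 - r) (fun r _ => by rw [hf, add_neg_cancel])
    (fun r _ _ => by omega) (fun r hr => ?_) (fun r _ => by ring)
  simp only [Finset.mem_Ico] at hr ⊢
  omega

theorem sum_Icc_fold {A : Type*} [AddCommMonoid A] (N : ℕ) (g : ℤ → A) :
    ∑ r ∈ Finset.Icc (-N : ℤ) N, g r =
      g 0 + ∑ n ∈ Finset.range N, (g (n + 1 : ℕ) + g (-(n + 1 : ℕ))) := by
  induction N with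
  | zero => simp
  | succ N ih =>
    have hIcc : Finset.Icc (-(N + 1 : ℕ) : ℤ) (N + 1 : ℕ) =
        insert ((N + 1 : ℕ) : ℤ) (insert (-(N + 1 : ℕ) : ℤ) (Finset.Icc (-N : ℤ) N)) := by
      ext x
      simp only [Finset.mem_Icc, Finset.mem_insert]
      omega
    rw [hIcc, Finset.sum_insert, Finset.sum_insert, ih, Finset.sum_range_succ]
    · rw [← add_assoc, add_comm, add_assoc]
    · simp only [Finset.mem_Icc]
      omega
    · simp only [Finset.mem_Icc, Finset.mem_insert]
      omega

section FiniteBailey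

variable {L : Type*} [Field L]

/-- The reciprocal of `qPoch q k`, extended by zero to negative `k`. -/
noncomputable def qInv (q : L) (k : ℤ) : L := if k < 0 then 0 else (qPoch q k.toNat)⁻¹

/-- The kernel `1 / ((q)_(n-r) (q)_(n+r))` of a Bailey pair. -/
noncomputable def baileyKernel (q : L) (n : ℕ) (r : ℤ) : L := qInv q (n - r) * qInv q (n + r)

/-- The bilateral sum `∑ A r / ((q)_(n-r) (q)_(n+r))`, truncated to `|r| ≤ N`. -/
noncomputable def baileySum (q : L) (N : ℕ) (A : ℤ → L) (n : ℕ) : L :=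
  ∑ r ∈ Finset.Icc (-N : ℤ) N, A r * baileyKernel q n r

theorem qInv_natCast (q : L) (n : ℕ) : qInv q n = (qPoch q n)⁻¹ := by simp [qInv]

theorem qInv_of_neg (q : L) {k : ℤ} (hk : k < 0) : qInv q k = 0 := if_pos hk

theorem one_sub_pow_ne_zero {q : L} (hq : ¬IsOfFinOrder q) (n : ℕ) : 1 - q ^ (n + 1) ≠ 0 :=
  sub_ne_zero.mpr fun h => hq (isOfFinOrder_iff_pow_eq_one.mpr ⟨n + 1, n.succ_pos, h.symm⟩)

theorem one_sub_zpow_ne_zero {q : L} (hq : ¬IsOfFinOrder q) {r : ℤ} (hr : r ≠ 0) :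
    1 - q ^ r ≠ 0 := by
  obtain ⟨n, rfl | rfl⟩ : ∃ n : ℕ, r = (n + 1 : ℕ) ∨ r = -(n + 1 : ℕ) :=
    ⟨r.natAbs - 1, by omega⟩
  · rw [zpow_natCast]
    exact one_sub_pow_ne_zero hq n
  · rw [zpow_neg, zpow_natCast, sub_ne_zero, ne_comm, inv_ne_one, ne_comm, ← sub_ne_zero]
    exact one_sub_pow_ne_zero hq n

theorem qPoch_ne_zero {q : L} (hq : ¬IsOfFinOrder q) (n : ℕ) : qPoch q n ≠ 0 :=
  Finset.prod_ne_zero_iff.mpr fun i _ => one_sub_pow_ne_zero hq i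

theorem qInv_pred {q : L} (hq : ¬IsOfFinOrder q) (k : ℤ) :
    qInv q (k - 1) = (1 - q ^ k) * qInv q k := by
  rcases lt_trichotomy k 0 with hk | rfl | hk
  · rw [qInv_of_neg q hk, qInv_of_neg q (by omega), mul_zero]
  · rw [qInv_of_neg q (by omega), zpow_zero, sub_self, zero_mul]
  · obtain ⟨n, rfl⟩ : ∃ n : ℕ, k = (n + 1 : ℕ) := ⟨(k - 1).toNat, by omega⟩
    rw [show ((n + 1 : ℕ) : ℤ) - 1 = n by omega, qInv_natCast, qInv_natCast, qPoch_succ,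
      zpow_natCast]
    have := qPoch_ne_zero hq n
    have := one_sub_pow_ne_zero hq n
    field_simp

theorem baileyKernel_neg (q : L) (n : ℕ) (r : ℤ) : baileyKernel q n (-r) = baileyKernel q n r := by
  rw [baileyKernel, baileyKernel, sub_neg_eq_add, ← sub_eq_add_neg, mul_comm]

theorem baileyKernel_zero_left (q : L) {r : ℤ} (hr : r ≠ 0) : baileyKernel q 0 r = 0 := by
  rw [baileyKernel, Nat.cast_zero, zero_sub, zero_add]
  rcases lt_or_gt_of_ne hr with h | h
  · rw [qInv_of_neg q h, mul_zero]
  · rw [qInv_of_neg q (neg_lt_zero.mpr h), zero_mul]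

theorem baileyKernel_pred {q : L} (hq : ¬IsOfFinOrder q) (n : ℕ) (r : ℤ) :
    baileyKernel q n r = (1 - q ^ ((n + 1 : ℕ) - r : ℤ)) * (1 - q ^ ((n + 1 : ℕ) + r : ℤ)) *
      baileyKernel q (n + 1) r := by
  rw [baileyKernel, show (n : ℤ) - r = ((n + 1 : ℕ) - r) - 1 by omega,
    show (n : ℤ) + r = ((n + 1 : ℕ) + r) - 1 by omega, qInv_pred hq, qInv_pred hq, baileyKernel]
  ring

theorem baileySum_zero (q : L) (N : ℕ) (A : ℤ → L) : baileySum q N A 0 = A 0 := by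
  rw [baileySum, Finset.sum_eq_single 0]
  · simp [baileyKernel, qInv, qPoch]
  · intro r _ hr
    rw [baileyKernel_zero_left q hr, mul_zero]
  · simp

theorem intSign_cast_neg_one_sub (r : ℤ) : ((intSign (-1 - r) : ℤ) : L) = -(intSign r : L) := by
  rw [show -1 - r = -(r + 1) by ring, intSign_neg, intSign_add]
  simp [intSign]

theorem sum_antisymm_mul_baileyKernel_eq_zero {q : L} (hq : ¬IsOfFinOrder q) {N n : ℕ} (hn : n ≤ N)
    {A : ℤ → L} (hA : ∀ r, A (-1 - r) = -A r) (α β : L) :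
    ∑ r ∈ Finset.Icc (-N : ℤ) N, (α * (A r * (1 - q ^ (n - r : ℤ))) +
      β * (A (-r) * (1 - q ^ (n + r : ℤ)))) * baileyKernel q n r = 0 := by
  have hleft : ∑ r ∈ Finset.Icc (-N : ℤ) N,
      A r * (1 - q ^ (n - r : ℤ)) * baileyKernel q n r = 0 := by
    refine sum_Icc_eq_zero_of_antisymm N _ (fun r => ?_) ?_
    · rw [hA, baileyKernel, baileyKernel, show (n : ℤ) - (-1 - r) = n + r + 1 by ring,
        show (n : ℤ) + (-1 - r) = n - r - 1 by ring, mul_assoc, ← mul_assoc (1 - _), ← qInv_pred hq,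
        mul_assoc, ← mul_assoc (1 - _), ← qInv_pred hq, add_sub_cancel_right]
      ring
    · rw [baileyKernel, mul_assoc, ← mul_assoc (1 - _), ← qInv_pred hq,
        qInv_of_neg q (show (n : ℤ) - N - 1 < 0 by omega)]
      ring
  have hright := hleft
  rw [← sum_Icc_neg] at hright
  simp only [baileyKernel_neg, sub_neg_eq_add] at hright
  have hcomb := congrArg₂ (fun x y => α * x + β * y) hleft hright
  simp only [Finset.mul_sum, ← Finset.sum_add_distrib, mul_zero, add_zero] at hcomb
  rw [← hcomb]
  exact Finset.sum_congr rfl fun r _ => by ring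

theorem baileySum_gauss_succ {q : L} (hq0 : q ≠ 0) (hq : ¬IsOfFinOrder q) {N n : ℕ}
    (hn : n + 1 ≤ N) :
    baileySum q N (fun r => intSign r * q ^ (r ^ 2)) (n + 1) *
        (1 - q ^ (n + 1) * q ^ (n + 1)) =
      baileySum q N (fun r => intSign r * q ^ (r ^ 2)) n := by
  have hA (r : ℤ) : (intSign (-1 - r) : L) * (q ^ (-1 - r) ^ 2 * q ^ ((n + 1 : ℕ) + (-1 - r) : ℤ)) =
      -((intSign r : L) * (q ^ r ^ 2 * q ^ ((n + 1 : ℕ) + r : ℤ))) := by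
    rw [intSign_cast_neg_one_sub, ← zpow_add₀ hq0, ← zpow_add₀ hq0,
      show (-1 - r) ^ 2 + ((n + 1 : ℕ) + (-1 - r) : ℤ) = r ^ 2 + ((n + 1 : ℕ) + r) by ring, neg_mul]
  rw [← sub_eq_zero, ← sum_antisymm_mul_baileyKernel_eq_zero hq hn
    (A := fun r => (intSign r : L) * (q ^ r ^ 2 * q ^ ((n + 1 : ℕ) + r : ℤ))) hA 1 1,
    baileySum, baileySum,
    Finset.sum_mul, ← Finset.sum_sub_distrib]
  refine Finset.sum_congr rfl fun r _ => ?_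
  have hprod : q ^ (n + 1) * q ^ (n + 1) =
      q ^ ((n + 1 : ℕ) - r : ℤ) * q ^ ((n + 1 : ℕ) + r : ℤ) := by
    rw [← zpow_add₀ hq0, ← zpow_natCast, ← zpow_add₀ hq0]
    congr 1
    ring
  rw [baileyKernel_pred hq n, hprod, intSign_neg, neg_sq, ← sub_eq_add_neg]
  ring

theorem baileySum_gauss {q : L} (hq0 : q ≠ 0) (hq : ¬IsOfFinOrder q) {N n : ℕ} (hn : n ≤ N) :
    baileySum q N (fun r => intSign r * q ^ (r ^ 2)) n * (qPoch q n * qPochPlus q n) = 1 := by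
  induction n with
  | zero => rw [baileySum_zero]; simp [qPoch, qPochPlus, intSign]
  | succ n ih =>
    rw [← ih (by omega), ← baileySum_gauss_succ hq0 hq hn, qPoch_succ, qPochPlus_succ]
    ring

theorem baileySum_jacobi_succ {p : L} (hp0 : p ≠ 0) (hp : ¬IsOfFinOrder (p ^ 2)) {N n : ℕ}
    (hn : n + 1 ≤ N) :
    baileySum (p ^ 2) N (fun r => intSign r * p ^ (r ^ 2)) (n + 1) *
        ((1 - (p ^ 2) ^ (2 * (n + 1))) * (1 + p ^ (2 * n + 1))) =
      baileySum (p ^ 2) N (fun r => intSign r * p ^ (r ^ 2)) n * (1 - p ^ (2 * n + 1)) := by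
  have hp2 : p ^ 2 ≠ 0 := pow_ne_zero 2 hp0
  have hA (r : ℤ) : (intSign (-1 - r) : L) * (p ^ (-1 - r) ^ 2 + p ^ (-1 - r + 1) ^ 2) =
      -((intSign r : L) * (p ^ r ^ 2 + p ^ (r + 1) ^ 2)) := by
    rw [intSign_cast_neg_one_sub, show (-1 - r) ^ 2 = (r + 1) ^ 2 by ring,
      show (-1 - r + 1) ^ 2 = r ^ 2 by ring]
    ring
  rw [← sub_eq_zero,
    ← sum_antisymm_mul_baileyKernel_eq_zero hp hn
      (A := fun r => (intSign r : L) * (p ^ r ^ 2 + p ^ (r + 1) ^ 2)) hA (p ^ (2 * n + 1))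
      (p ^ (2 * n + 1)),
    baileySum, baileySum, Finset.sum_mul, Finset.sum_mul, ← Finset.sum_sub_distrib]
  refine Finset.sum_congr rfl fun r _ => ?_
  have hleft : (p ^ 2) ^ ((n + 1 : ℕ) - r : ℤ) = p * p ^ (2 * n + 1) * (p ^ 2) ^ (-r) := by
    rw [sub_eq_add_neg, zpow_add₀ hp2, zpow_natCast]
    ring
  have hright : (p ^ 2) ^ ((n + 1 : ℕ) + r : ℤ) = p * p ^ (2 * n + 1) * (p ^ 2) ^ r := by
    rw [zpow_add₀ hp2, zpow_natCast]
    ring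
  have hsq (r : ℤ) : p ^ (r + 1) ^ 2 = p ^ r ^ 2 * p * (p ^ 2) ^ r := by
    rw [← zpow_natCast, ← zpow_mul, ← zpow_add_one₀ hp0, ← zpow_add₀ hp0]
    congr 1
    push_cast
    ring
  have hcancel : (p ^ 2) ^ r * (p ^ 2) ^ (-r) = 1 := by
    rw [← zpow_add₀ hp2, add_neg_cancel, zpow_zero]
  rw [baileyKernel_pred hp n, hsq, hsq, intSign_neg, neg_sq, hleft, hright]
  linear_combination ((intSign r : L) * p ^ r ^ 2 * baileyKernel (p ^ 2) (n + 1) r * p ^ 2 *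
    (p ^ (2 * n + 1)) ^ 2 * (1 + p ^ (2 * n + 1))) * hcancel

theorem baileySum_jacobi {p : L} (hp0 : p ≠ 0) (hp : ¬IsOfFinOrder (p ^ 2)) {N n : ℕ}
    (hn : n ≤ N) :
    baileySum (p ^ 2) N (fun r => intSign r * p ^ (r ^ 2)) n *
      (qPoch (p ^ 2) n * qPochPlus p (2 * n)) * qPoch (p ^ 2) n = qPoch p (2 * n) := by
  induction n with
  | zero => rw [baileySum_zero]; simp [qPoch, qPochPlus, intSign]
  | succ n ih =>
    rw [show 2 * (n + 1) = 2 * n + 1 + 1 by ring, qPoch_succ, qPochPlus_succ, qPochPlus_succ,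
      qPoch_succ p, qPoch_succ p, ← ih (by omega)]
    linear_combination (qPoch (p ^ 2) n ^ 2 * qPochPlus p (2 * n) * (1 - p ^ (2 * n + 2))) *
      baileySum_jacobi_succ hp0 hp hn

theorem baileySum_unit {p : L} (hp0 : p ≠ 0) (hp : ¬IsOfFinOrder (p ^ 2)) {N n : ℕ}
    (hn : n + 1 ≤ N) :
    baileySum (p ^ 2) N (fun r => intSign r * p ^ (r ^ 2 - r)) (n + 1) = 0 := by
  have hA (r : ℤ) : (intSign (-1 - r) : L) * p ^ ((-1 - r) ^ 2 + (-1 - r)) =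
      -((intSign r : L) * p ^ (r ^ 2 + r)) := by
    rw [intSign_cast_neg_one_sub, show (-1 - r) ^ 2 + (-1 - r) = r ^ 2 + r by ring, neg_mul]
  have hmul : baileySum (p ^ 2) N (fun r => (intSign r : L) * p ^ (r ^ 2 - r)) (n + 1) *
      (1 - (p ^ 2) ^ (2 * n + 1 + 1)) = 0 := by
    rw [← sum_antisymm_mul_baileyKernel_eq_zero hp hn
      (A := fun r => (intSign r : L) * p ^ (r ^ 2 + r)) hA ((p ^ 2) ^ (n + 1)) 1, baileySum,
      Finset.sum_mul]
    refine Finset.sum_congr rfl fun r _ => ?_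
    have hleft : (p ^ 2) ^ ((n + 1 : ℕ) - r : ℤ) * (p ^ 2) ^ r = (p ^ 2) ^ (n + 1) := by
      rw [← zpow_add₀ (pow_ne_zero 2 hp0), sub_add_cancel, zpow_natCast]
    have hright : (p ^ 2) ^ ((n + 1 : ℕ) + r : ℤ) = (p ^ 2) ^ (n + 1) * (p ^ 2) ^ r := by
      rw [zpow_add₀ (pow_ne_zero 2 hp0), zpow_natCast]
    have hweight : p ^ (r ^ 2 + r) = p ^ (r ^ 2 - r) * (p ^ 2) ^ r := by
      rw [← zpow_natCast, ← zpow_mul, ← zpow_add₀ hp0]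
      congr 1
      push_cast
      ring
    rw [intSign_neg, neg_sq, ← sub_eq_add_neg, hweight, hright]
    linear_combination (intSign r : L) * p ^ (r ^ 2 - r) * baileyKernel (p ^ 2) (n + 1) r *
      (p ^ 2) ^ (n + 1) * hleft
  exact (mul_eq_zero.mp hmul).resolve_right (one_sub_pow_ne_zero hp _)

theorem sum_conjugate_bailey {q : L} (hq0 : q ≠ 0) (hq : ¬IsOfFinOrder q) {r : ℤ} (hr : r ≠ 0)
    (N : ℕ) :
    ∑ n ∈ Finset.range N, qPoch q n ^ 2 * q ^ (n + 1) * baileyKernel q (n + 1) r =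
      q ^ r / (1 - q ^ r) ^ 2 * (qPoch q N ^ 2 * baileyKernel q N r) := by
  induction N with
  | zero => rw [Finset.sum_range_zero, baileyKernel_zero_left q hr, mul_zero, mul_zero]
  | succ N ih =>
    rw [Finset.sum_range_succ, ih, baileyKernel_pred hq N, qPoch_succ, zpow_sub₀ hq0, zpow_add₀ hq0,
      zpow_natCast]
    have := one_sub_zpow_ne_zero hq hr
    have := zpow_ne_zero r hq0
    field_simp
    ring

theorem sum_conjugate_bailey_zero {q : L} (hq : ¬IsOfFinOrder q) (N : ℕ) :
    ∑ n ∈ Finset.range N, qPoch q n ^ 2 * q ^ (n + 1) * baileyKernel q (n + 1) 0 =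
      ∑ n ∈ Finset.range N, q ^ (n + 1) / (1 - q ^ (n + 1)) ^ 2 := by
  refine Finset.sum_congr rfl fun n _ => ?_
  rw [baileyKernel, sub_zero, add_zero, qInv_natCast, qPoch_succ]
  have := qPoch_ne_zero hq n
  have := one_sub_pow_ne_zero hq n
  field_simp

theorem baileyKernel_of_le (q : L) {m N : ℕ} (hm : m ≤ N) :
    baileyKernel q N m = (qPoch q (N - m))⁻¹ * (qPoch q (N + m))⁻¹ := by
  rw [baileyKernel, ← Nat.cast_sub hm, ← Nat.cast_add, qInv_natCast, qInv_natCast]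

/-- Bailey's lemma with both parameters tending to `1`, the case that produces smallest parts
functions. -/
theorem sum_baileySum {q : L} (hq0 : q ≠ 0) (hq : ¬IsOfFinOrder q) (N : ℕ) (A : ℤ → L) :
    ∑ n ∈ Finset.range N, qPoch q n ^ 2 * q ^ (n + 1) * baileySum q N A (n + 1) =
      A 0 * ∑ n ∈ Finset.range N, q ^ (n + 1) / (1 - q ^ (n + 1)) ^ 2 +
      ∑ n ∈ Finset.range N, (A (n + 1 : ℕ) + A (-(n + 1 : ℕ))) *
        (q ^ (n + 1) / (1 - q ^ (n + 1)) ^ 2) *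
        (qPoch q N ^ 2 * ((qPoch q (N - (n + 1)))⁻¹ * (qPoch q (N + (n + 1)))⁻¹)) := by
  have hswap : ∑ n ∈ Finset.range N, qPoch q n ^ 2 * q ^ (n + 1) * baileySum q N A (n + 1) =
      ∑ r ∈ Finset.Icc (-N : ℤ) N, A r *
        ∑ n ∈ Finset.range N, qPoch q n ^ 2 * q ^ (n + 1) * baileyKernel q (n + 1) r := by
    simp only [baileySum, Finset.mul_sum]
    rw [Finset.sum_comm]
    exact Finset.sum_congr rfl fun r _ => Finset.sum_congr rfl fun n _ => by ring
  rw [hswap, sum_Icc_fold, sum_conjugate_bailey_zero hq]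
  congr 1
  refine Finset.sum_congr rfl fun m hm => ?_
  simp only [baileyKernel_neg]
  rw [← add_mul, sum_conjugate_bailey hq0 hq (by omega), zpow_natCast,
    baileyKernel_of_le q (Finset.mem_range.mp hm)]
  ring

end FiniteBailey

theorem X_pow_dvd_qSum_posPairs_sub {R : Type*} [CommRing R] {e : ℤ × ℤ → ℤ}
    (he : ∀ x ∈ posPairs, x.1 ≤ e x ∧ x.2 ≤ e x) (w : ℤ × ℤ → R) (N : ℕ) :
    X ^ (N + 1) ∣ qSum posPairs e w - ∑ a ∈ Finset.range N,
      qSum (Set.Ici 1) (fun m => e ((a + 1 : ℕ), m)) fun m => w ((a + 1 : ℕ), m) := by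
  classical
  rw [X_pow_dvd_iff]
  intro n hn
  have hmem (a : ℕ) {m : ℤ} (hm : 1 ≤ m) : (((a + 1 : ℕ) : ℤ), m) ∈ posPairs := ⟨by simp, hm⟩
  rw [map_sub, sub_eq_zero, map_sum, coeff_qSum_eq_sum
    (((Finset.range N).image fun a : ℕ => ((a + 1 : ℕ) : ℤ)) ×ˢ Finset.Icc 1 (n : ℤ)) n,
    Finset.sum_product, Finset.sum_image fun a _ b _ h => by simpa using h]
  · refine Finset.sum_congr rfl fun a _ => (coeff_qSum_eq_sum _ n (fun m hm hem => ?_) ?_).symm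
    · have := (he _ (hmem a hm)).2
      exact Finset.mem_Icc.mpr ⟨hm, by omega⟩
    · exact fun m hm => (Finset.mem_Icc.mp hm).1
  · intro x hx hex
    have := he x hx
    obtain ⟨hx1, hx2⟩ := hx
    simp only [Finset.mem_product, Finset.mem_image, Finset.mem_range, Finset.mem_Icc]
    exact ⟨⟨(x.1 - 1).toNat, by omega, by omega⟩, hx2, by omega⟩
  · intro x hx
    simp only [Finset.mem_product, Finset.mem_image, Finset.mem_Icc] at hx
    obtain ⟨⟨a, -, ha⟩, hm, -⟩ := hx
    exact ⟨by omega, hm⟩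

theorem qSummable_multiples {k : ℕ} (hk : k ≠ 0) :
    QSummable (Set.Ici 1) fun m : ℤ => (k : ℤ) * m := by
  refine ⟨fun m hm => ?_, fun N => (Set.finite_Icc 1 N).subset fun m hm => ⟨hm.1, ?_⟩⟩
  · have : (1 : ℤ) ≤ m := hm
    positivity
  · have : (1 : ℤ) ≤ m := hm.1
    exact le_trans (le_mul_of_one_le_left (by omega) (by omega)) hm.2

theorem qSum_Ici_one {R : Type*} [CommRing R] :
    qSum (Set.Ici (1 : ℤ)) id (fun _ => (1 : R)) = X * PowerSeries.mk 1 := by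
  ext n
  rw [coeff_qSum_eq_sum (Finset.Icc 1 (n : ℤ)) n (fun m hm h => ?_) (by simp +contextual)]
  · cases n <;> simp [coeff_succ_X_mul]
  · simp_all

theorem one_sub_X_pow_mul_qSum {R : Type*} [CommRing R] {k : ℕ} (hk : k ≠ 0) :
    (1 - X ^ k) * qSum (Set.Ici 1) (fun m : ℤ => (k : ℤ) * m) (fun _ => (1 : R)) = X ^ k := by
  have h : (1 - X) * qSum (Set.Ici (1 : ℤ)) id (fun _ => (1 : R)) = X := by
    rw [qSum_Ici_one]
    linear_combination X * mk_one_mul_one_sub_eq_one R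
  simpa [expand_qSum, expand_X] using congrArg (PowerSeries.expand k hk) h

theorem one_sub_X_pow_sq_mul_qSum {R : Type*} [CommRing R] {k : ℕ} (hk : k ≠ 0) :
    (1 - X ^ k) ^ 2 * qSum (Set.Ici 1) (fun m : ℤ => (k : ℤ) * m) (fun m => (m : R)) = X ^ k := by
  have hsum : QSummable (Set.Ici (1 : ℤ)) id :=
    (qSummable_multiples one_ne_zero).of_le fun m _ => by simp
  have hderiv : qSum (Set.Ici (1 : ℤ)) id (fun m => (m : R)) =
      qDeriv R (X * PowerSeries.mk 1) := by
    rw [← qSum_Ici_one, qDeriv_qSum hsum]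
    simp
  have h : (1 - X) ^ 2 * qSum (Set.Ici (1 : ℤ)) id (fun m => (m : R)) = X := by
    have hgeom := mk_one_mul_one_sub_eq_one R
    have hD := congrArg (qDeriv R) hgeom
    have hX : qDeriv R X = X := by simpa using qDeriv_X_pow (R := R) 1
    rw [Derivation.leibniz, map_sub, hX, Derivation.map_one_eq_zero, smul_eq_mul, smul_eq_mul] at hD
    rw [hderiv, Derivation.leibniz, hX, smul_eq_mul, smul_eq_mul]
    linear_combination X * (1 - X) * hD + X * hgeom
  simpa [expand_qSum, expand_X] using congrArg (PowerSeries.expand k hk) h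

theorem one_sub_X_pow_mul_inv {k : ℕ} (hk : k ≠ 0) :
    (1 - X ^ k : ℚ⟦X⟧) * (1 - X ^ k)⁻¹ = 1 :=
  PowerSeries.mul_inv_cancel _ (by simp [hk])

/-- The power series `u / (1 - u)^2`. -/
noncomputable def koebe (u : ℚ⟦X⟧) : ℚ⟦X⟧ := u * (1 - u)⁻¹ ^ 2

theorem koebe_X_pow {k : ℕ} (hk : k ≠ 0) :
    koebe (X ^ k) = qSum (Set.Ici 1) (fun m : ℤ => (k : ℤ) * m) fun m => (m : ℚ) := by
  rw [koebe]
  nth_rw 1 [← one_sub_X_pow_sq_mul_qSum (R := ℚ) hk]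
  rw [mul_right_comm, ← mul_pow, one_sub_X_pow_mul_inv hk, one_pow, one_mul]

local notation "toRat" => PowerSeries.map (Int.castRingHom ℚ)

/-- The series `∑ (-1)^a m q^(a^2 + d a m)` over positive integers `a`, `m`. It is the rank series
when `d = 2`; the case `d = 1` plays the corresponding role for cranks. -/
noncomputable def signedSquareSeries (d : ℕ) : ℤ⟦X⟧ :=
  qSum posPairs (fun x => x.1 ^ 2 + d * (x.1 * x.2)) fun x => intSign x.1 * x.2

theorem signedSquareSeries_two : signedSquareSeries 2 = rankSeries 1 := by
  simp [signedSquareSeries, rankSeries]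

theorem sigmaSeries_one_eq_lambert_snd (d : ℤ) : sigmaSeries 1 d = lambert d Prod.snd := by
  rw [sigmaSeries, ← lambert_swap]
  simp

theorem intSign_natCast (n : ℕ) : intSign n = (-1) ^ n := by
  simp [intSign, Int.negOnePow_def]

theorem X_pow_dvd_sigmaSeries_sub {d : ℕ} (hd : d ≠ 0) (N : ℕ) :
    X ^ (N + 1) ∣ toRat (sigmaSeries 1 d) - ∑ n ∈ Finset.range N, koebe (X ^ (d * (n + 1))) := by
  have hd' : (1 : ℤ) ≤ d := by omega
  have hrow (n : ℕ) : koebe (X ^ (d * (n + 1))) = qSum (Set.Ici 1)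
      (fun m : ℤ => d * ((n + 1 : ℕ) * m)) fun m => (m : ℚ) := by
    rw [koebe_X_pow (by positivity)]
    exact qSum_congr (fun m _ => by push_cast; ring) fun m _ => rfl
  rw [sigmaSeries_one_eq_lambert_snd, lambert, map_qSum _ (qSummable_lambert hd'),
    Finset.sum_congr rfl fun n _ => hrow n]
  exact X_pow_dvd_qSum_posPairs_sub (fun _ => le_mul_mul_of_mem_posPairs hd') (fun x => (x.2 : ℚ)) N

theorem X_pow_dvd_signedSquareSeries_sub {d : ℕ} (hd : d ≠ 0) (N : ℕ) :
    X ^ (N + 1) ∣ toRat (signedSquareSeries d) -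
      ∑ n ∈ Finset.range N, (-1) ^ (n + 1) * X ^ (n + 1) ^ 2 * koebe (X ^ (d * (n + 1))) := by
  have he (x : ℤ × ℤ) (hx : x ∈ posPairs) :
      x.1 ≤ x.1 ^ 2 + d * (x.1 * x.2) ∧ x.2 ≤ x.1 ^ 2 + d * (x.1 * x.2) := by
    have := le_mul_mul_of_mem_posPairs (d := d) (by omega) hx
    constructor <;> nlinarith
  have hrow (n : ℕ) : (-1) ^ (n + 1) * X ^ (n + 1) ^ 2 * koebe (X ^ (d * (n + 1))) =
      qSum (Set.Ici 1) (fun m : ℤ => (n + 1 : ℕ) ^ 2 + d * ((n + 1 : ℕ) * m))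
        fun m => ((intSign (n + 1 : ℕ) * m : ℤ) : ℚ) := by
    have hk := qSummable_multiples (k := d * (n + 1)) (by positivity)
    rw [koebe_X_pow (by positivity), mul_assoc, X_pow_mul_qSum hk,
      show (-1 : ℚ⟦X⟧) ^ (n + 1) = C ((-1) ^ (n + 1)) by simp, ← qSum_const_mul]
    · refine qSum_congr (fun m _ => by push_cast; ring) fun m _ => ?_
      rw [intSign_natCast]
      push_cast
      rfl
    · exact hk.of_le fun m _ => le_add_of_nonneg_left (by positivity)
  rw [signedSquareSeries, map_qSum _ (qSummable_posPairs he),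
    Finset.sum_congr rfl fun n _ => hrow n]
  exact X_pow_dvd_qSum_posPairs_sub he (fun x => ((intSign x.1 * x.2 : ℤ) : ℚ)) N

theorem map_qPoch {A B : Type*} [CommRing A] [CommRing B] (f : A →+* B) (q : A) (n : ℕ) :
    f (qPoch q n) = qPoch (f q) n := by simp [qPoch]

theorem map_qPochPlus {A B : Type*} [CommRing A] [CommRing B] (f : A →+* B) (q : A) (n : ℕ) :
    f (qPochPlus q n) = qPochPlus (f q) n := by simp [qPochPlus]

theorem constantCoeff_qPoch {q : ℚ⟦X⟧} (hq : constantCoeff q = 0) (n : ℕ) :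
    constantCoeff (qPoch q n) = 1 := by simp [hq, qPoch]

theorem constantCoeff_qPochPlus {q : ℚ⟦X⟧} (hq : constantCoeff q = 0) (n : ℕ) :
    constantCoeff (qPochPlus q n) = 1 := by simp [hq, qPochPlus]

theorem constantCoeff_X_pow {d : ℕ} (hd : d ≠ 0) : constantCoeff (X ^ d : ℚ⟦X⟧) = 0 := by
  simp [hd]

theorem qPoch_mul_inv {q : ℚ⟦X⟧} (hq : constantCoeff q = 0) (n : ℕ) :
    qPoch q n * (qPoch q n)⁻¹ = 1 :=
  PowerSeries.mul_inv_cancel _ (by simp [constantCoeff_qPoch hq])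

theorem qPochPlus_mul_inv {q : ℚ⟦X⟧} (hq : constantCoeff q = 0) (n : ℕ) :
    qPochPlus q n * (qPochPlus q n)⁻¹ = 1 :=
  PowerSeries.mul_inv_cancel _ (by simp [constantCoeff_qPochPlus hq])

/-- The ratio `(q)_N ^ 2 / ((q)_(N-r) (q)_(N+r))`, which tends to `1` as `N` grows. -/
noncomputable def qPochRatio (q : ℚ⟦X⟧) (N r : ℕ) : ℚ⟦X⟧ :=
  qPoch q N ^ 2 * ((qPoch q (N - r))⁻¹ * (qPoch q (N + r))⁻¹)

theorem X_pow_dvd_qPoch_sub {d : ℕ} (hd : d ≠ 0) (m k : ℕ) :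
    (X : ℚ⟦X⟧) ^ (m + 1) ∣ qPoch (X ^ d) (m + k) - qPoch (X ^ d) m := by
  induction k with
  | zero => simp
  | succ k ih =>
    rw [← add_assoc, qPoch_succ, mul_one_sub, sub_right_comm, ← pow_mul]
    have : m + 1 ≤ d * (m + k + 1) := by nlinarith [Nat.one_le_iff_ne_zero.mpr hd]
    exact dvd_sub ih ((pow_dvd_pow _ this).mul_left _)

theorem X_pow_dvd_qPochRatio_sub_one {d : ℕ} (hd : d ≠ 0) {N r : ℕ} (hr : r ≤ N) :
    (X : ℚ⟦X⟧) ^ (N - r + 1) ∣ qPochRatio (X ^ d) N r - 1 := by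
  obtain ⟨a, ha⟩ := X_pow_dvd_qPoch_sub hd (N - r) r
  obtain ⟨b, hb⟩ := (pow_dvd_pow (X : ℚ⟦X⟧) (show N - r + 1 ≤ N + 1 by omega)).trans
    (X_pow_dvd_qPoch_sub hd N r)
  rw [Nat.sub_add_cancel hr] at ha
  have h1 := qPoch_mul_inv (constantCoeff_X_pow hd) (N - r)
  have h2 := qPoch_mul_inv (constantCoeff_X_pow hd) (N + r)
  rw [qPochRatio]
  set A := qPoch (X ^ d : ℚ⟦X⟧) (N - r)
  set B := qPoch (X ^ d : ℚ⟦X⟧) (N + r)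
  set P := qPoch (X ^ d : ℚ⟦X⟧) N
  refine ⟨A⁻¹ * B⁻¹ * (a * P - A * b), ?_⟩
  linear_combination (A⁻¹ * B⁻¹ * P) * ha - (A⁻¹ * B⁻¹ * A) * hb + (B * B⁻¹) * h1 + h2

theorem X_pow_dvd_sum_qPochRatio_sub {d : ℕ} (hd : d ≠ 0) (N : ℕ) {g : ℕ → ℚ⟦X⟧}
    (hg : ∀ n, X ^ (n + 1) ^ 2 ∣ g n) :
    X ^ (N + 1) ∣ ∑ n ∈ Finset.range N, g n * qPochRatio (X ^ d) N (n + 1) -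
      ∑ n ∈ Finset.range N, g n := by
  rw [← Finset.sum_sub_distrib]
  refine Finset.dvd_sum fun n hn => ?_
  have hnN : n + 1 ≤ N := Finset.mem_range.mp hn
  have hdvd := mul_dvd_mul (hg n) (X_pow_dvd_qPochRatio_sub_one hd hnN)
  rw [← pow_add, mul_sub_one] at hdvd
  refine (pow_dvd_pow X ?_).trans hdvd
  have : n + 1 ≤ (n + 1) ^ 2 := by nlinarith
  omega

/-- The finite Gauss product `(1 - q) ⋯ (1 - q^n) / ((1 + q) ⋯ (1 + q^n))`, a partial product of
`theta`. -/
noncomputable def gaussProd (n : ℕ) : ℚ⟦X⟧ := qPoch X n * (qPochPlus X n)⁻¹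

section Transfer

local notation "toFrac" => algebraMap ℚ⟦X⟧ (FractionRing ℚ⟦X⟧)

theorem algebraMap_fractionRing_inv {u : ℚ⟦X⟧} (hu : constantCoeff u ≠ 0) :
    toFrac u⁻¹ = (toFrac u)⁻¹ := by
  refine eq_inv_of_mul_eq_one_left ?_
  rw [← map_mul, PowerSeries.inv_mul_cancel _ hu, map_one]

theorem algebraMap_fractionRing_injective : Function.Injective toFrac :=
  IsFractionRing.injective _ _

theorem algebraMap_X_ne_zero : toFrac X ≠ 0 :=
  (map_ne_zero_iff _ algebraMap_fractionRing_injective).mpr X_ne_zero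

theorem not_isOfFinOrder_algebraMap_X_pow {d : ℕ} (hd : d ≠ 0) :
    ¬IsOfFinOrder (toFrac X ^ d) := by
  rw [isOfFinOrder_iff_pow_eq_one]
  rintro ⟨n, hn, h⟩
  rw [← map_pow, ← map_pow, ← map_one toFrac, algebraMap_fractionRing_injective.eq_iff] at h
  simpa [hd, hn.ne'] using congrArg constantCoeff h

theorem algebraMap_koebe {d : ℕ} (hd : d ≠ 0) :
    toFrac (koebe (X ^ d)) = toFrac X ^ d / (1 - toFrac X ^ d) ^ 2 := by
  rw [koebe, map_mul, map_pow, map_pow, algebraMap_fractionRing_inv (by simp [hd]),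
    map_sub, map_one, map_pow, inv_pow, div_eq_mul_inv]

theorem algebraMap_qPochRatio {d : ℕ} (hd : d ≠ 0) (N r : ℕ) :
    toFrac (qPochRatio (X ^ d) N r) = qPoch (toFrac X ^ d) N ^ 2 *
      ((qPoch (toFrac X ^ d) (N - r))⁻¹ * (qPoch (toFrac X ^ d) (N + r))⁻¹) := by
  have h (n : ℕ) : constantCoeff (qPoch (X ^ d : ℚ⟦X⟧) n) ≠ 0 := by
    simp [constantCoeff_qPoch (constantCoeff_X_pow hd)]
  rw [qPochRatio, map_mul, map_mul, map_pow, algebraMap_fractionRing_inv (h _),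
    algebraMap_fractionRing_inv (h _), map_qPoch, map_qPoch, map_qPoch, map_pow]

theorem qPochPlus_algebraMap_X_ne_zero (n : ℕ) : qPochPlus (toFrac X) n ≠ 0 := by
  rw [← map_qPochPlus, map_ne_zero_iff _ algebraMap_fractionRing_injective]
  intro h
  simpa [h] using constantCoeff_qPochPlus (q := X) constantCoeff_X n

theorem algebraMap_gaussProd (n : ℕ) :
    toFrac (gaussProd n) = qPoch (toFrac X) n / qPochPlus (toFrac X) n := by
  rw [gaussProd, map_mul, algebraMap_fractionRing_inv
    (by simp [constantCoeff_qPochPlus (q := X) constantCoeff_X]), map_qPoch, map_qPochPlus,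
    div_eq_mul_inv]

theorem intSign_mul_zpow_sq_add_neg {L : Type*} [Field L] (q : L) (n : ℕ) :
    (intSign n : L) * q ^ ((n : ℤ) ^ 2) + (intSign (-n) : L) * q ^ ((-n : ℤ) ^ 2) =
      2 * (-1) ^ n * q ^ n ^ 2 := by
  rw [intSign_neg, neg_sq, intSign_natCast, ← Nat.cast_pow, zpow_natCast]
  push_cast
  ring

/-- The limiting form of `sum_baileySum` as `N` grows, with error terms for formal power series. -/
theorem X_pow_dvd_sum_sub_of_baileySum {d : ℕ} (hd : d ≠ 0) {N : ℕ} {A : ℤ → FractionRing ℚ⟦X⟧}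
    (hA : A 0 = 1) {B C : ℕ → ℚ⟦X⟧}
    (hB : ∀ n < N, qPoch (toFrac X ^ d) n ^ 2 * (toFrac X ^ d) ^ (n + 1) *
      baileySum (toFrac X ^ d) N A (n + 1) = toFrac (B n))
    (hC : ∀ n : ℕ, (A (n + 1 : ℕ) + A (-(n + 1 : ℕ))) *
      toFrac (koebe (X ^ (d * (n + 1)))) = toFrac (C n))
    (hCX : ∀ n, X ^ (n + 1) ^ 2 ∣ C n) :
    X ^ (N + 1) ∣ ∑ n ∈ Finset.range N, B n -
      (∑ n ∈ Finset.range N, koebe (X ^ (d * (n + 1))) + ∑ n ∈ Finset.range N, C n) := by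
  have hk (n : ℕ) : (toFrac X ^ d) ^ (n + 1) / (1 - (toFrac X ^ d) ^ (n + 1)) ^ 2 =
      toFrac (koebe (X ^ (d * (n + 1)))) := by
    rw [algebraMap_koebe (by positivity), pow_mul]
  have hfinite : ∑ n ∈ Finset.range N, B n = ∑ n ∈ Finset.range N, koebe (X ^ (d * (n + 1))) +
      ∑ n ∈ Finset.range N, C n * qPochRatio (X ^ d) N (n + 1) := by
    apply algebraMap_fractionRing_injective
    have hbailey := sum_baileySum (pow_ne_zero d algebraMap_X_ne_zero)
      (not_isOfFinOrder_algebraMap_X_pow hd) N A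
    rw [Finset.sum_congr rfl fun n hn => hB n (Finset.mem_range.mp hn), hA, one_mul] at hbailey
    simp only [hk, hC, ← algebraMap_qPochRatio hd] at hbailey
    simpa only [map_add, map_sum, map_mul] using hbailey
  rw [hfinite, add_sub_add_left_eq_sub]
  exact X_pow_dvd_sum_qPochRatio_sub hd N hCX

theorem X_pow_dvd_sum_koebe_mul_gaussProd_sub (N : ℕ) :
    X ^ (N + 1) ∣ ∑ n ∈ Finset.range N, koebe (X ^ (n + 1)) * gaussProd (n + 1) -
      (∑ n ∈ Finset.range N, koebe (X ^ (1 * (n + 1))) +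
        ∑ n ∈ Finset.range N,
          2 * (-1) ^ (n + 1) * X ^ (n + 1) ^ 2 * koebe (X ^ (1 * (n + 1)))) := by
  have hq0 := algebraMap_X_ne_zero
  have hq : ¬IsOfFinOrder (toFrac X) := by
    simpa using not_isOfFinOrder_algebraMap_X_pow one_ne_zero
  refine X_pow_dvd_sum_sub_of_baileySum one_ne_zero
    (A := fun r => (intSign r : FractionRing ℚ⟦X⟧) * toFrac X ^ (r ^ 2)) (by simp [intSign])
    (fun n hn => ?_) (fun n => ?_) fun n => (Dvd.intro_left _ rfl).mul_right _
  · have hgauss := baileySum_gauss hq0 hq (Nat.succ_le_of_lt hn)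
    have h2 := qPochPlus_algebraMap_X_ne_zero (n + 1)
    have h3 := qPoch_ne_zero hq n
    have h4 := one_sub_pow_ne_zero hq n
    rw [pow_one, eq_inv_of_mul_eq_one_left hgauss, map_mul, algebraMap_koebe n.succ_ne_zero,
      algebraMap_gaussProd, qPoch_succ]
    field_simp
  · simp only [intSign_mul_zpow_sq_add_neg, map_mul, map_pow, map_neg, map_one, map_ofNat]

theorem X_pow_dvd_sum_koebe_even_mul_gaussProd_sub (N : ℕ) :
    X ^ (N + 1) ∣ ∑ n ∈ Finset.range N, koebe (X ^ (2 * (n + 1))) * gaussProd (2 * (n + 1)) -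
      (∑ n ∈ Finset.range N, koebe (X ^ (2 * (n + 1))) +
        ∑ n ∈ Finset.range N,
          2 * (-1) ^ (n + 1) * X ^ (n + 1) ^ 2 * koebe (X ^ (2 * (n + 1)))) := by
  have hq0 := algebraMap_X_ne_zero
  have hq := not_isOfFinOrder_algebraMap_X_pow two_ne_zero
  refine X_pow_dvd_sum_sub_of_baileySum two_ne_zero
    (A := fun r => (intSign r : FractionRing ℚ⟦X⟧) * toFrac X ^ (r ^ 2)) (by simp [intSign])
    (fun n hn => ?_) (fun n => ?_) fun n => (Dvd.intro_left _ rfl).mul_right _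
  · have hjacobi := baileySum_jacobi hq0 hq (Nat.succ_le_of_lt hn)
    have h2 := qPochPlus_algebraMap_X_ne_zero (2 * (n + 1))
    have h4 := one_sub_pow_ne_zero hq n
    rw [map_mul, algebraMap_koebe (by positivity), algebraMap_gaussProd, ← hjacobi, qPoch_succ,
      pow_mul]
    field_simp
  · simp only [intSign_mul_zpow_sq_add_neg, map_mul, map_pow, map_neg, map_one, map_ofNat]

theorem koebe_sub_two_mul_koebe_sq {n : ℕ} (hn : n ≠ 0) :
    X ^ n * (koebe (X ^ n) - 2 * koebe (X ^ (2 * n))) =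
      (1 + X ^ (2 * n)) * koebe (X ^ (2 * n)) := by
  have hinv : (1 - X ^ n : ℚ⟦X⟧)⁻¹ = (1 + X ^ n) * (1 - X ^ (2 * n))⁻¹ := by
    rw [PowerSeries.inv_eq_iff_mul_eq_one (by simp [hn])]
    linear_combination one_sub_X_pow_mul_inv (k := 2 * n) (by positivity)
  rw [koebe, koebe, hinv]
  ring

theorem intSign_mul_zpow_sq_sub_add_neg {L : Type*} [Field L] {q : L} (hq0 : q ≠ 0) (n : ℕ) :
    q ^ n * ((intSign n : L) * q ^ ((n : ℤ) ^ 2 - n) +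
      (intSign (-n) : L) * q ^ ((-n : ℤ) ^ 2 - -n)) = (-1) ^ n * q ^ n ^ 2 * (1 + q ^ (2 * n)) := by
  have h1 : q ^ n * q ^ ((n : ℤ) ^ 2 - n) = q ^ n ^ 2 := by
    rw [← zpow_natCast, ← zpow_add₀ hq0, ← zpow_natCast]
    congr 1
    push_cast
    ring
  have h2 : q ^ ((-n : ℤ) ^ 2 - -n) = q ^ n ^ 2 * q ^ n := by
    rw [← pow_add, ← zpow_natCast]
    congr 1
    push_cast
    ring
  rw [intSign_neg, intSign_natCast, h2, two_mul, pow_add]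
  push_cast
  linear_combination (-1) ^ n * h1

theorem X_pow_dvd_sum_koebe_unit (N : ℕ) :
    X ^ (N + 1) ∣ ∑ n ∈ Finset.range N, koebe (X ^ (2 * (n + 1))) +
      ∑ n ∈ Finset.range N, (-1) ^ (n + 1) * X ^ (n + 1) ^ 2 *
        (koebe (X ^ (n + 1)) - 2 * koebe (X ^ (2 * (n + 1)))) := by
  have hq0 := algebraMap_X_ne_zero
  have hq := not_isOfFinOrder_algebraMap_X_pow two_ne_zero
  suffices h : X ^ (N + 1) ∣ ∑ _n ∈ Finset.range N, (0 : ℚ⟦X⟧) -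
      (∑ n ∈ Finset.range N, koebe (X ^ (2 * (n + 1))) +
      ∑ n ∈ Finset.range N, (-1) ^ (n + 1) * X ^ (n + 1) ^ 2 *
        (koebe (X ^ (n + 1)) - 2 * koebe (X ^ (2 * (n + 1))))) by
    simpa only [Finset.sum_const_zero, zero_sub, dvd_neg] using h
  refine X_pow_dvd_sum_sub_of_baileySum two_ne_zero
    (A := fun r => (intSign r : FractionRing ℚ⟦X⟧) * toFrac X ^ (r ^ 2 - r)) (by simp [intSign])
    (fun n hn => ?_) (fun n => ?_) fun n => (Dvd.intro_left _ rfl).mul_right _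
  · rw [baileySum_unit hq0 hq hn, mul_zero, map_zero]
  · have hkoebe := congrArg toFrac (koebe_sub_two_mul_koebe_sq (n := n + 1) n.succ_ne_zero)
    have hA := intSign_mul_zpow_sq_sub_add_neg hq0 (n + 1)
    simp only [map_mul, map_add, map_sub, map_pow, map_one, map_ofNat, map_neg] at hkoebe hA ⊢
    refine mul_left_cancel₀ (pow_ne_zero (n + 1) hq0) ?_
    linear_combination toFrac (koebe (X ^ (2 * (n + 1)))) * hA -
      (-1) ^ (n + 1) * toFrac X ^ (n + 1) ^ 2 * hkoebe

theorem gaussProd_eq_sum (N : ℕ) :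
    gaussProd N = 1 + ∑ n ∈ Finset.range N,
      2 * (-1) ^ (n + 1) * X ^ (n + 1) ^ 2 * qPochRatio (X ^ 1) N (n + 1) := by
  have hq : ¬IsOfFinOrder (toFrac X) := by
    simpa using not_isOfFinOrder_algebraMap_X_pow one_ne_zero
  apply algebraMap_fractionRing_injective
  have hprod : toFrac (gaussProd N) = qPoch (toFrac X) N ^ 2 *
      baileySum (toFrac X) N (fun r => (intSign r : FractionRing ℚ⟦X⟧) * toFrac X ^ (r ^ 2)) N := by
    have hgauss := baileySum_gauss algebraMap_X_ne_zero hq le_rfl (N := N)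
    have := qPochPlus_algebraMap_X_ne_zero N
    have := qPoch_ne_zero hq N
    rw [algebraMap_gaussProd, eq_inv_of_mul_eq_one_left hgauss]
    field_simp
  rw [hprod, baileySum, sum_Icc_fold, mul_add, Finset.mul_sum, map_add, map_sum, map_one]
  congr 1
  · have := qPoch_ne_zero hq N
    rw [← Nat.cast_zero, baileyKernel_of_le _ N.zero_le]
    simp [intSign]
    field_simp
  · refine Finset.sum_congr rfl fun n hn => ?_
    have hnN : n + 1 ≤ N := Finset.mem_range.mp hn
    rw [baileyKernel_neg, baileyKernel_of_le _ hnN, ← add_mul, intSign_mul_zpow_sq_add_neg, map_mul,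
      algebraMap_qPochRatio one_ne_zero, pow_one]
    simp only [map_mul, map_pow, map_neg, map_one, map_ofNat]
    ring

end Transfer

theorem X_pow_dvd_theta_sub_sum (N : ℕ) :
    X ^ (N + 1) ∣ toRat theta -
      (1 + ∑ n ∈ Finset.range N, 2 * (-1) ^ (n + 1) * X ^ (n + 1) ^ 2) := by
  rw [X_pow_dvd_iff]
  intro m hm
  have hterm (n : ℕ) : coeff m (2 * (-1) ^ (n + 1) * X ^ (n + 1) ^ 2 : ℚ⟦X⟧) =
      if m = (n + 1) ^ 2 then 2 * (-1) ^ (n + 1) else 0 := by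
    rw [show (2 * (-1) ^ (n + 1) : ℚ⟦X⟧) = C (2 * (-1) ^ (n + 1)) by simp [map_ofNat C],
      coeff_C_mul_X_pow]
  rw [map_sub, sub_eq_zero, theta, thetaMoment, map_qSum _ (qSummable_sq _),
    coeff_qSum_eq_sum (Finset.Icc (-N : ℤ) N) m (fun t _ ht => ?_) (fun _ _ => Set.mem_univ _),
    sum_Icc_fold, map_add, map_sum]
  · congr 1
    · simp [intSign, coeff_one, eq_comm]
    · refine Finset.sum_congr rfl fun n _ => ?_
      have hexp : ((n + 1 : ℕ) : ℤ) ^ 2 = m ↔ m = (n + 1) ^ 2 := by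
        rw [← Nat.cast_pow, Nat.cast_inj, eq_comm]
      rw [hterm, intSign_neg, neg_sq, intSign_natCast]
      simp only [hexp]
      split_ifs <;> simp [two_mul]
  · rw [Finset.mem_Icc]
    constructor <;> nlinarith

theorem X_pow_dvd_theta_sub_gaussProd (N : ℕ) : X ^ (N + 1) ∣ toRat theta - gaussProd N := by
  have hratio := X_pow_dvd_sum_qPochRatio_sub one_ne_zero N
    (g := fun n => 2 * (-1) ^ (n + 1) * X ^ (n + 1) ^ 2) fun n => Dvd.intro_left _ rfl
  rw [gaussProd_eq_sum]
  convert dvd_sub (X_pow_dvd_theta_sub_sum N) hratio using 1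
  ring

theorem toRat_injective : Function.Injective toRat :=
  PowerSeries.map_injective _ Int.cast_injective

theorem signedSquareSeries_one :
    signedSquareSeries 1 = 2 * rankSeries 1 - sigmaSeries 1 2 := by
  rw [← signedSquareSeries_two]
  refine toRat_injective (eq_of_forall_X_pow_dvd_sub fun N => ?_)
  have hsigma := X_pow_dvd_sigmaSeries_sub two_ne_zero N
  have hone := X_pow_dvd_signedSquareSeries_sub one_ne_zero N
  have htwo := X_pow_dvd_signedSquareSeries_sub two_ne_zero N
  have hunit := X_pow_dvd_sum_koebe_unit N
  simp only [mul_sub, mul_left_comm _ (2 : ℚ⟦X⟧), Finset.sum_sub_distrib, ← Finset.mul_sum]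
    at hunit
  convert dvd_add (dvd_add (dvd_sub hone (htwo.mul_left 2)) hsigma) hunit using 1
  simp only [map_sub, map_mul, map_ofNat, Nat.cast_ofNat, one_mul]
  ring

theorem X_pow_dvd_sum_koebe_mul_gaussProd_sub_series (N : ℕ) :
    X ^ (N + 1) ∣ ∑ n ∈ Finset.range N, koebe (X ^ (n + 1)) * gaussProd (n + 1) -
      toRat (sigmaSeries 1 1 - 2 * sigmaSeries 1 2 + 4 * rankSeries 1) := by
  have hbailey := X_pow_dvd_sum_koebe_mul_gaussProd_sub N
  have hsigma := X_pow_dvd_sigmaSeries_sub one_ne_zero N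
  have hsquare := X_pow_dvd_signedSquareSeries_sub one_ne_zero N
  have hone : sigmaSeries 1 1 - 2 * sigmaSeries 1 2 + 4 * rankSeries 1 =
      sigmaSeries 1 1 + 2 * signedSquareSeries 1 := by
    rw [signedSquareSeries_one]
    ring
  simp only [mul_assoc (2 : ℚ⟦X⟧), ← Finset.mul_sum] at hbailey
  rw [hone]
  convert dvd_sub (dvd_sub hbailey hsigma) (hsquare.mul_left 2) using 1
  simp only [map_add, map_mul, map_ofNat, Nat.cast_one, mul_assoc]
  ring

theorem X_pow_dvd_sum_koebe_even_mul_gaussProd_sub_series (N : ℕ) :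
    X ^ (N + 1) ∣
      ∑ n ∈ Finset.range N, koebe (X ^ (2 * (n + 1))) * gaussProd (2 * (n + 1)) -
        toRat (sigmaSeries 1 2 + 2 * rankSeries 1) := by
  have hbailey := X_pow_dvd_sum_koebe_even_mul_gaussProd_sub N
  have hsigma := X_pow_dvd_sigmaSeries_sub two_ne_zero N
  have hsquare := X_pow_dvd_signedSquareSeries_sub two_ne_zero N
  simp only [mul_assoc (2 : ℚ⟦X⟧), ← Finset.mul_sum] at hbailey
  convert dvd_sub (dvd_sub hbailey hsigma) (hsquare.mul_left 2) using 1
  rw [← signedSquareSeries_two]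
  simp only [map_add, map_mul, map_ofNat, Nat.cast_ofNat, mul_assoc]
  ring

/-! ### Generating functions of overpartitions -/

/-- The smallest part of a partition, and `0` for the empty partition, following the convention of
`Overpartition.smallestPart`. -/
def minPart {n : ℕ} (p : n.Partition) : ℕ := p.parts.toFinset.min.untopD 0

theorem minPart_eq_iff {n : ℕ} (p : n.Partition) {j : ℕ} (hj : j ≠ 0) :
    minPart p = j ↔ j ∈ p.parts ∧ ∀ i ∈ p.parts, j ≤ i := by
  rcases Finset.eq_empty_or_nonempty p.parts.toFinset with h | h
  · have h0 : p.parts = 0 := by simpa using h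
    simp [minPart, h0, hj.symm]
  · rw [minPart, ← Finset.coe_min' h, WithTop.untopD_coe]
    constructor
    · rintro rfl
      exact ⟨Multiset.mem_toFinset.mp (Finset.min'_mem _ h),
        fun i hi => Finset.min'_le _ _ (Multiset.mem_toFinset.mpr hi)⟩
    · rintro ⟨hmem, hle⟩
      exact le_antisymm (Finset.min'_le _ _ (Multiset.mem_toFinset.mpr hmem))
        (Finset.le_min' _ _ _ fun i hi => hle i (Multiset.mem_toFinset.mp hi))

theorem le_of_mem_parts {n : ℕ} {p : n.Partition} {i : ℕ} (hi : i ∈ p.parts) : i ≤ n :=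
  (Multiset.single_le_sum (fun _ _ => Nat.zero_le _) _ hi).trans_eq p.parts_sum

theorem minPart_le {n : ℕ} (p : n.Partition) : minPart p ≤ n := by
  rcases eq_or_ne (minPart p) 0 with h | h
  · simp [h]
  · exact le_of_mem_parts ((minPart_eq_iff p h).mp rfl).1

theorem count_minPart_of_eq_zero {n : ℕ} {p : n.Partition} (h : minPart p = 0) :
    p.parts.count (minPart p) = 0 := by
  rw [h, Multiset.count_eq_zero]
  exact fun h0 => (p.parts_pos h0).ne rfl

theorem sum_overpartition {M : Type*} [AddCommMonoid M] {n : ℕ} (F : n.Partition → M) :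
    ∑ l : Overpartition n, F l.partition =
      ∑ p : n.Partition, 2 ^ p.parts.toFinset.card • F p := by
  have hsigma : ∑ l : Overpartition n, F l.partition =
      ∑ x : Σ p : n.Partition, {S : Finset ℕ // S ∈ p.parts.toFinset.powerset}, F x.1 :=
    Fintype.sum_equiv (Overpartition.equivSigma n) _ _ fun _ => rfl
  rw [hsigma, Fintype.sum_sigma]
  refine Finset.sum_congr rfl fun p _ => ?_
  refine (Finset.sum_const (F p)).trans ?_
  rw [Finset.card_univ, Fintype.card_coe, Finset.card_powerset]

/-- The multiplicative weight whose partition generating function counts the overpartitions with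
all parts greater than `j`; each distinct part contributes a factor `2`, for its overlining. -/
def largeWeight (j i _c : ℕ) : ℚ := if i ≤ j then 0 else 2

/-- The multiplicative weight whose partition generating function counts the overpartitions with
no part below `j`, the ones containing `j` being weighted by the multiplicity of `j`. -/
def countWeight (j i c : ℕ) : ℚ := if i < j then 0 else if i = j then 2 * c else 2

theorem prod_countWeight_of_mem {n : ℕ} (p : n.Partition) {j : ℕ} (hj : j ∈ p.parts)
    (hle : ∀ i ∈ p.parts, j ≤ i) : p.parts.toFinsupp.prod (countWeight j) =
      2 ^ p.parts.toFinset.card * p.parts.count j := by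
  have hj' := Multiset.mem_toFinset.mpr hj
  have hrest : ∀ i ∈ p.parts.toFinset.erase j, countWeight j i (p.parts.count i) = 2 := by
    intro i hi
    rw [Finset.mem_erase, Multiset.mem_toFinset] at hi
    simp [countWeight, hi.1, hle i hi.2]
  simp only [Finsupp.prod, Multiset.toFinsupp_support, Multiset.toFinsupp_apply]
  rw [← Finset.mul_prod_erase _ _ hj', Finset.prod_congr rfl hrest, Finset.prod_const,
    ← Finset.card_erase_add_one hj', pow_succ, countWeight, if_neg (lt_irrefl j), if_pos rfl]
  ring

theorem prod_largeWeight_of_le {n : ℕ} (p : n.Partition) {i j : ℕ} (hi : i ∈ p.parts)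
    (hij : i ≤ j) : p.parts.toFinsupp.prod (largeWeight j) = 0 :=
  Finset.prod_eq_zero (i := i) (by simpa using hi) (if_pos hij)

theorem prod_countWeight_of_lt {n : ℕ} (p : n.Partition) {i j : ℕ} (hi : i ∈ p.parts)
    (hij : i < j) : p.parts.toFinsupp.prod (countWeight j) = 0 :=
  Finset.prod_eq_zero (i := i) (by simpa using hi) (if_pos hij)

theorem prod_countWeight_of_notMem {n : ℕ} (p : n.Partition) {j : ℕ} (hj : j ∉ p.parts) :
    p.parts.toFinsupp.prod (countWeight j) = p.parts.toFinsupp.prod (largeWeight j) := by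
  refine Finset.prod_congr rfl fun i hi => ?_
  have hij : i ≠ j := by
    rintro rfl
    exact hj (by simpa using hi)
  simp only [countWeight, largeWeight, if_neg hij, hij.le_iff_lt]

theorem prod_countWeight_sub_prod_largeWeight {n : ℕ} (p : n.Partition) {j : ℕ} (hj : j ≠ 0) :
    p.parts.toFinsupp.prod (countWeight j) - p.parts.toFinsupp.prod (largeWeight j) =
      if minPart p = j then (2 : ℚ) ^ p.parts.toFinset.card * p.parts.count j else 0 := by
  rw [if_congr (minPart_eq_iff p hj) rfl rfl]
  split_ifs with h
  · rw [prod_countWeight_of_mem p h.1 h.2, prod_largeWeight_of_le p h.1 le_rfl, sub_zero]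
  · rw [sub_eq_zero]
    by_cases hmem : j ∈ p.parts
    · obtain ⟨i, hi, hij⟩ : ∃ i ∈ p.parts, i < j := by
        by_contra! hle
        exact h ⟨hmem, hle⟩
      rw [prod_countWeight_of_lt p hi hij, prod_largeWeight_of_le p hi hij.le]
    · exact prod_countWeight_of_notMem p hmem

/-- The generating function of overpartitions all of whose parts exceed `j`. -/
noncomputable def largeSeries (j : ℕ) : ℚ⟦X⟧ := Nat.Partition.genFun (largeWeight j)

/-- For `j ≠ 0`, the generating function of the number of occurrences of `j` in the overpartitions
with smallest part `j`. -/
noncomputable def smallestSeries (j : ℕ) : ℚ⟦X⟧ :=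
  Nat.Partition.genFun (countWeight j) - largeSeries j

theorem coeff_smallestSeries {j : ℕ} (hj : j ≠ 0) (n : ℕ) : coeff n (smallestSeries j) =
    ∑ p : n.Partition, if minPart p = j then
      (2 : ℚ) ^ p.parts.toFinset.card * p.parts.count j else 0 := by
  rw [smallestSeries, largeSeries, map_sub, Nat.Partition.coeff_genFun, Nat.Partition.coeff_genFun,
    ← Finset.sum_sub_distrib]
  exact Finset.sum_congr rfl fun p _ => prod_countWeight_sub_prod_largeWeight p hj

section Factor

open scoped PowerSeries.WithPiTopology

theorem genFun_eq_mul (f f' : ℕ → ℕ → ℚ) (j : ℕ) (hne : ∀ i, i ≠ j + 1 → f i = f' i)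
    (h0 : f' (j + 1) = 0) : Nat.Partition.genFun f = Nat.Partition.genFun f' *
      (1 + ∑' k, f (j + 1) (k + 1) • (X : ℚ⟦X⟧) ^ ((j + 1) * (k + 1))) := by
  have hf' := (Nat.Partition.hasProd_genFun f').mul (hasProd_ite_eq j
    (1 + ∑' k, f (j + 1) (k + 1) • (X : ℚ⟦X⟧) ^ ((j + 1) * (k + 1))))
  refine (Nat.Partition.hasProd_genFun f).unique (hf'.congr_fun fun i => ?_)
  by_cases h : i = j
  · subst h
    simp [h0]
  · simp [h, hne (i + 1) (by omega)]

theorem summable_X_pow_succ_pow (j : ℕ) :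
    Summable fun k => ((X : ℚ⟦X⟧) ^ (j + 1)) ^ (k + 1) :=
  (summable_nat_add_iff 1).mpr
    (WithPiTopology.summable_pow_of_constantCoeff_eq_zero (constantCoeff_X_pow j.succ_ne_zero))

theorem summable_succ_mul_X_pow_succ_pow (j : ℕ) :
    Summable fun k : ℕ => ((k + 1 : ℕ) : ℚ⟦X⟧) * (X ^ (j + 1)) ^ (k + 1) :=
  (Nat.Partition.summable_genFun_term (fun _ c => (c : ℚ)) j).congr fun k => by
    rw [smul_eq_C_mul, map_natCast, pow_mul]

theorem one_sub_mul_tsum_X_pow_succ (j : ℕ) :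
    (1 - X ^ (j + 1)) * ∑' k, ((X : ℚ⟦X⟧) ^ (j + 1)) ^ (k + 1) = X ^ (j + 1) := by
  have h0 : constantCoeff (X ^ (j + 1) : ℚ⟦X⟧) = 0 := constantCoeff_X_pow j.succ_ne_zero
  have hgeom := WithPiTopology.one_sub_mul_tsum_pow_of_constantCoeff_eq_zero h0
  rw [(WithPiTopology.summable_pow_of_constantCoeff_eq_zero h0).tsum_eq_zero_add, pow_zero] at hgeom
  linear_combination hgeom

theorem one_sub_mul_tsum_succ_mul_X_pow_succ (j : ℕ) :
    (1 - X ^ (j + 1)) * ∑' k : ℕ, ((k + 1 : ℕ) : ℚ⟦X⟧) * (X ^ (j + 1)) ^ (k + 1) =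
      ∑' k, (X ^ (j + 1)) ^ (k + 1) := by
  have hs := summable_succ_mul_X_pow_succ_pow j
  rw [one_sub_mul, ← hs.tsum_mul_left, hs.tsum_eq_zero_add,
    (summable_X_pow_succ_pow j).tsum_eq_zero_add, add_sub_assoc,
    ← Summable.tsum_sub ((summable_nat_add_iff 1).mpr hs) (hs.mul_left _)]
  congr 1
  · simp
  · refine tsum_congr fun k => ?_
    push_cast
    ring

theorem tsum_succ_mul_X_pow_succ (j : ℕ) :
    ∑' k : ℕ, ((k + 1 : ℕ) : ℚ⟦X⟧) * (X ^ (j + 1)) ^ (k + 1) = koebe (X ^ (j + 1)) := by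
  have hinv : (1 - X ^ (j + 1) : ℚ⟦X⟧) * (1 - X ^ (j + 1))⁻¹ = 1 :=
    one_sub_X_pow_mul_inv j.succ_ne_zero
  have hone := one_sub_mul_tsum_X_pow_succ j
  have hsucc := one_sub_mul_tsum_succ_mul_X_pow_succ j
  rw [koebe]
  set S := ∑' k : ℕ, ((k + 1 : ℕ) : ℚ⟦X⟧) * (X ^ (j + 1)) ^ (k + 1)
  set v := (1 - X ^ (j + 1) : ℚ⟦X⟧)⁻¹
  linear_combination (-S * ((1 - X ^ (j + 1)) * v + 1)) * hinv +
    v ^ 2 * (1 - X ^ (j + 1)) * hsucc + v ^ 2 * hone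

theorem one_sub_X_pow_mul_largeSeries (j : ℕ) :
    (1 - X ^ (j + 1)) * largeSeries j = (1 + X ^ (j + 1)) * largeSeries (j + 1) := by
  have hfactor := genFun_eq_mul (largeWeight j) (largeWeight (j + 1)) j
    (fun i hi => by
      ext c
      have : i ≤ j ↔ i ≤ j + 1 := by omega
      simp only [largeWeight, this]) (by ext c; simp [largeWeight])
  have hterm (k : ℕ) : largeWeight j (j + 1) (k + 1) • (X : ℚ⟦X⟧) ^ ((j + 1) * (k + 1)) =
      2 * (X ^ (j + 1)) ^ (k + 1) := by
    rw [largeWeight, if_neg (by omega), smul_eq_C_mul, map_ofNat, pow_mul]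
  rw [tsum_congr hterm, (summable_X_pow_succ_pow j).tsum_mul_left] at hfactor
  rw [largeSeries, largeSeries, hfactor]
  linear_combination
    2 * Nat.Partition.genFun (largeWeight (j + 1)) * one_sub_mul_tsum_X_pow_succ j

theorem genFun_countWeight (j : ℕ) : Nat.Partition.genFun (countWeight (j + 1)) =
    largeSeries (j + 1) * (1 + 2 * koebe (X ^ (j + 1))) := by
  have hfactor := genFun_eq_mul (countWeight (j + 1)) (largeWeight (j + 1)) j
    (fun i hi => by
      ext c
      simp only [countWeight, largeWeight, if_neg hi, hi.le_iff_lt]) (by ext c; simp [largeWeight])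
  have hterm (k : ℕ) : countWeight (j + 1) (j + 1) (k + 1) • (X : ℚ⟦X⟧) ^ ((j + 1) * (k + 1)) =
      2 * (((k + 1 : ℕ) : ℚ⟦X⟧) * (X ^ (j + 1)) ^ (k + 1)) := by
    rw [countWeight, if_neg (lt_irrefl _), if_pos rfl, smul_eq_C_mul, map_mul, map_ofNat,
      map_natCast, pow_mul, mul_assoc]
  rw [hfactor, tsum_congr hterm, (summable_succ_mul_X_pow_succ_pow j).tsum_mul_left,
    tsum_succ_mul_X_pow_succ, largeSeries]

end Factor

theorem smallestSeries_succ (j : ℕ) :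
    smallestSeries (j + 1) = 2 * koebe (X ^ (j + 1)) * largeSeries (j + 1) := by
  rw [smallestSeries, genFun_countWeight]
  ring

theorem qPoch_mul_largeSeries_zero (n : ℕ) :
    qPoch X n * largeSeries 0 = qPochPlus X n * largeSeries n := by
  induction n with
  | zero => simp [qPoch, qPochPlus]
  | succ n ih =>
    rw [qPoch_succ, qPochPlus_succ]
    linear_combination (1 - X ^ (n + 1)) * ih + qPochPlus X n * one_sub_X_pow_mul_largeSeries n

theorem gaussProd_mul_largeSeries_zero (n : ℕ) : gaussProd n * largeSeries 0 = largeSeries n := by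
  rw [gaussProd]
  linear_combination (qPochPlus (X : ℚ⟦X⟧) n)⁻¹ * qPoch_mul_largeSeries_zero n +
    largeSeries n * qPochPlus_mul_inv constantCoeff_X n

theorem X_pow_dvd_largeSeries_sub_one (N : ℕ) : X ^ (N + 1) ∣ largeSeries N - 1 := by
  rw [X_pow_dvd_iff]
  intro n hn
  rw [map_sub, sub_eq_zero, largeSeries, Nat.Partition.coeff_genFun, coeff_one]
  split_ifs with h
  · subst h
    simp [Nat.Partition.partition_zero_parts]
  · refine Finset.sum_eq_zero fun p _ => ?_
    obtain ⟨i, hi⟩ : ∃ i, i ∈ p.parts := by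
      refine Multiset.exists_mem_of_ne_zero fun h0 => h ?_
      rw [← p.parts_sum, h0, Multiset.sum_zero]
    exact prod_largeWeight_of_le p hi ((le_of_mem_parts hi).trans (by omega))

theorem toRat_theta_mul_largeSeries_zero : toRat theta * largeSeries 0 = 1 := by
  refine eq_of_forall_X_pow_dvd_sub fun N => ?_
  convert dvd_add ((X_pow_dvd_theta_sub_gaussProd N).mul_right (largeSeries 0))
    (X_pow_dvd_largeSeries_sub_one N) using 1
  linear_combination gaussProd_mul_largeSeries_zero N

theorem toRat_theta_mul_largeSeries (n : ℕ) : toRat theta * largeSeries n = gaussProd n := by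
  linear_combination gaussProd n * toRat_theta_mul_largeSeries_zero -
    toRat theta * gaussProd_mul_largeSeries_zero n

theorem toRat_theta_mul_smallestSeries {j : ℕ} (hj : j ≠ 0) :
    toRat theta * smallestSeries j = 2 * (koebe (X ^ j) * gaussProd j) := by
  obtain ⟨j, rfl⟩ := Nat.exists_eq_add_one_of_ne_zero hj
  rw [smallestSeries_succ, ← toRat_theta_mul_largeSeries]
  ring

/-- The generating function of `sptBar`. -/
noncomputable def sptSeries : ℤ⟦X⟧ := PowerSeries.mk fun n => (sptBar n : ℤ)

/-- The generating function of `sptBar2`. -/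
noncomputable def sptSeriesEven : ℤ⟦X⟧ := PowerSeries.mk fun n => (sptBar2 n : ℤ)

theorem sum_ite_minPart_eq {n N m : ℕ} (hn : n ≤ N) (hm : m ≠ 0) (p : n.Partition) :
    (∑ k ∈ Finset.range N, if minPart p = m * (k + 1) then
        (2 : ℚ) ^ p.parts.toFinset.card * p.parts.count (m * (k + 1)) else 0) =
      2 ^ p.parts.toFinset.card •
        if m ∣ minPart p then (p.parts.count (minPart p) : ℚ) else 0 := by
  rcases eq_or_ne (minPart p) 0 with h0 | h0
  · rw [count_minPart_of_eq_zero h0, Nat.cast_zero, ite_self, smul_zero, h0]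
    exact Finset.sum_eq_zero fun k _ => if_neg (by positivity)
  by_cases hdvd : m ∣ minPart p
  · obtain ⟨k, hk⟩ := hdvd
    obtain ⟨k, rfl⟩ := Nat.exists_eq_add_one_of_ne_zero (right_ne_zero_of_mul (hk ▸ h0))
    have hkN : k < N := by
      have hle : k + 1 ≤ m * (k + 1) := Nat.le_mul_of_pos_left _ (Nat.pos_of_ne_zero hm)
      exact Nat.lt_of_succ_le (hle.trans (hk ▸ (minPart_le p).trans hn))
    rw [Finset.sum_eq_single_of_mem k (Finset.mem_range.mpr hkN) fun i _ hik => ?_, if_pos hk, hk,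
      if_pos (Nat.dvd_mul_right m _), nsmul_eq_mul]
    · push_cast
      rfl
    · rw [hk, if_neg]
      simpa [hm] using hik.symm
  · rw [if_neg hdvd, smul_zero]
    exact Finset.sum_eq_zero fun k _ => if_neg fun h => hdvd ⟨k + 1, h⟩

theorem sum_smallestPartCount_eq_coeff {n N m : ℕ} (hn : n ≤ N) (hm : m ≠ 0) :
    (∑ l : Overpartition n, if m ∣ l.smallestPart then (l.smallestPartCount : ℚ) else 0) =
      coeff n (∑ k ∈ Finset.range N, smallestSeries (m * (k + 1))) := by
  rw [map_sum, Finset.sum_congr rfl fun k _ =>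
    coeff_smallestSeries (mul_ne_zero hm k.succ_ne_zero) n, Finset.sum_comm,
    Finset.sum_congr rfl fun p _ => sum_ite_minPart_eq hn hm p]
  exact sum_overpartition fun p : n.Partition =>
    if m ∣ minPart p then (p.parts.count (minPart p) : ℚ) else 0

theorem sptBar_eq_sum (n : ℕ) : sptBar n = ∑ l : Overpartition n, l.smallestPartCount := by
  rw [sptBar, sptBar1, sptBar2, ← Finset.sum_add_distrib]
  refine Finset.sum_congr rfl fun l _ => ?_
  rcases Nat.even_or_odd l.smallestPart with h | h
  · simp [h, Nat.not_odd_iff_even.mpr h]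
  · simp [h, Nat.not_even_iff_odd.mpr h]

theorem X_pow_dvd_sptSeriesEven_sub (N : ℕ) : X ^ (N + 1) ∣ toRat sptSeriesEven -
    ∑ k ∈ Finset.range N, smallestSeries (2 * (k + 1)) := by
  rw [X_pow_dvd_iff]
  intro n hn
  rw [map_sub, ← sum_smallestPartCount_eq_coeff (Nat.lt_succ_iff.mp hn) two_ne_zero]
  simp [sptSeriesEven, sptBar2, even_iff_two_dvd]

theorem X_pow_dvd_sptSeries_sub (N : ℕ) : X ^ (N + 1) ∣ toRat sptSeries -
    ∑ k ∈ Finset.range N, smallestSeries (1 * (k + 1)) := by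
  rw [X_pow_dvd_iff]
  intro n hn
  rw [map_sub, ← sum_smallestPartCount_eq_coeff (Nat.lt_succ_iff.mp hn) one_ne_zero]
  simp [sptSeries, sptBar_eq_sum]

theorem toRat_theta_mul_sum_smallestSeries {m : ℕ} (hm : m ≠ 0) (N : ℕ) :
    toRat theta * ∑ k ∈ Finset.range N, smallestSeries (m * (k + 1)) =
      2 * ∑ k ∈ Finset.range N, koebe (X ^ (m * (k + 1))) * gaussProd (m * (k + 1)) := by
  rw [Finset.mul_sum, Finset.mul_sum]
  exact Finset.sum_congr rfl fun k _ =>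
    toRat_theta_mul_smallestSeries (mul_ne_zero hm k.succ_ne_zero)

theorem theta_mul_sptSeriesEven :
    theta * sptSeriesEven = 2 * sigmaSeries 1 2 + 4 * rankSeries 1 := by
  refine toRat_injective (eq_of_forall_X_pow_dvd_sub fun N => ?_)
  convert dvd_add ((X_pow_dvd_sptSeriesEven_sub N).mul_left (toRat theta))
    ((X_pow_dvd_sum_koebe_even_mul_gaussProd_sub_series N).mul_left 2) using 1
  simp only [map_add, map_mul, map_ofNat]
  linear_combination toRat_theta_mul_sum_smallestSeries two_ne_zero N

theorem theta_mul_sptSeries :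
    theta * sptSeries = 2 * sigmaSeries 1 1 - 4 * sigmaSeries 1 2 + 8 * rankSeries 1 := by
  refine toRat_injective (eq_of_forall_X_pow_dvd_sub fun N => ?_)
  have hsum := toRat_theta_mul_sum_smallestSeries one_ne_zero N
  convert dvd_add ((X_pow_dvd_sptSeries_sub N).mul_left (toRat theta))
    ((X_pow_dvd_sum_koebe_mul_gaussProd_sub_series N).mul_left 2) using 1
  simp only [map_add, map_sub, map_mul, map_ofNat, one_mul] at hsum ⊢
  linear_combination hsum

/-! ### Reduction modulo a prime -/

/-- The term `u / (1 - u)` of a Lambert series. -/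
noncomputable def lambertTerm (u : ℚ⟦X⟧) : ℚ⟦X⟧ := u * (1 - u)⁻¹

theorem lambertTerm_X_pow {k : ℕ} (hk : k ≠ 0) :
    lambertTerm (X ^ k) = qSum (Set.Ici 1) (fun m : ℤ => (k : ℤ) * m) fun _ => 1 := by
  rw [lambertTerm]
  linear_combination
    qSum (Set.Ici 1) (fun m : ℤ => (k : ℤ) * m) (fun _ => 1) * one_sub_X_pow_mul_inv hk -
      (1 - X ^ k)⁻¹ * one_sub_X_pow_mul_qSum (R := ℚ) hk

theorem X_pow_dvd_sigmaSeries_sub_sum_lambertTerm {d : ℕ} (hd : d ≠ 0) (N : ℕ) :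
    X ^ (N + 1) ∣ toRat (sigmaSeries 1 d) -
      ∑ a ∈ Finset.range N, ((a + 1 : ℕ) : ℚ⟦X⟧) * lambertTerm (X ^ (d * (a + 1))) := by
  have hd' : (1 : ℤ) ≤ d := by omega
  have hrow (a : ℕ) : ((a + 1 : ℕ) : ℚ⟦X⟧) * lambertTerm (X ^ (d * (a + 1))) =
      qSum (Set.Ici 1) (fun m : ℤ => (d : ℤ) * ((a + 1 : ℕ) * m))
        fun _ => (((a + 1 : ℕ) : ℤ) : ℚ) := by
    have hk : d * (a + 1) ≠ 0 := by positivity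
    rw [lambertTerm_X_pow hk, ← map_natCast (C (R := ℚ)),
      ← qSum_const_mul (qSummable_multiples hk)]
    exact qSum_congr (fun m _ => by push_cast; ring) fun m _ => by simp
  simp only [sigmaSeries, lambert, pow_one]
  rw [map_qSum _ (qSummable_lambert hd'), Finset.sum_congr rfl fun a _ => hrow a]
  exact X_pow_dvd_qSum_posPairs_sub (fun _ => le_mul_mul_of_mem_posPairs hd') (fun x => (x.1 : ℚ)) N

theorem gaussProd_succ_mul (n : ℕ) :
    gaussProd (n + 1) * (1 + X ^ (n + 1)) = gaussProd n * (1 - X ^ (n + 1)) := by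
  have h := qPochPlus_mul_inv constantCoeff_X n
  have h' := qPochPlus_mul_inv constantCoeff_X (n + 1)
  rw [qPochPlus_succ] at h'
  rw [gaussProd, gaussProd, qPoch_succ, qPochPlus_succ]
  linear_combination
    qPoch X n * (1 - X ^ (n + 1)) * ((qPochPlus X n)⁻¹ * h' -
      (qPochPlus X n * (1 + X ^ (n + 1)))⁻¹ * (1 + X ^ (n + 1)) * h)

theorem one_sub_mul_lambertTerm_sub {k : ℕ} (hk : k ≠ 0) :
    (1 - X ^ k) * (1 + X ^ k) * (lambertTerm (X ^ (2 * k)) - lambertTerm (X ^ k)) = -X ^ k := by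
  rw [lambertTerm, lambertTerm]
  linear_combination X ^ (2 * k) * one_sub_X_pow_mul_inv (k := 2 * k) (by positivity) -
    (1 + X ^ k) * X ^ k * one_sub_X_pow_mul_inv hk

theorem qDeriv_gaussProd (N : ℕ) : qDeriv ℚ (gaussProd N) = 2 *
    (∑ a ∈ Finset.range N, ((a + 1 : ℕ) : ℚ⟦X⟧) * lambertTerm (X ^ (2 * (a + 1))) -
      ∑ a ∈ Finset.range N, ((a + 1 : ℕ) : ℚ⟦X⟧) * lambertTerm (X ^ (1 * (a + 1)))) *
        gaussProd N := by
  induction N with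
  | zero => simp [gaussProd, qPoch, qPochPlus]
  | succ n ih =>
    have hsucc := gaussProd_succ_mul n
    have hderiv := congrArg (qDeriv ℚ) hsucc
    have hterm := one_sub_mul_lambertTerm_sub n.succ_ne_zero
    have hunit : IsUnit ((1 - X ^ (n + 1)) * (1 + X ^ (n + 1)) : ℚ⟦X⟧) :=
      isUnit_iff_constantCoeff.mpr (by simp)
    simp only [Derivation.leibniz, map_add, map_sub, Derivation.map_one_eq_zero, qDeriv_X_pow,
      smul_eq_mul, ih] at hderiv
    rw [Finset.sum_range_succ, Finset.sum_range_succ]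
    refine hunit.mul_left_cancel ?_
    simp only [one_mul, Nat.succ_eq_add_one] at hderiv hterm ⊢
    set L := ∑ a ∈ Finset.range n, ((a + 1 : ℕ) : ℚ⟦X⟧) * lambertTerm (X ^ (2 * (a + 1))) -
      ∑ a ∈ Finset.range n, ((a + 1 : ℕ) : ℚ⟦X⟧) * lambertTerm (X ^ (a + 1))
    linear_combination (1 - X ^ (n + 1)) * hderiv -
      2 * ((n + 1 : ℕ) : ℚ⟦X⟧) * gaussProd (n + 1) * hterm -
      (2 * L * (1 - X ^ (n + 1)) - ((n + 1 : ℕ) : ℚ⟦X⟧) * X ^ (n + 1)) * hsucc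

theorem qDeriv_theta : qDeriv ℤ theta = 2 * (sigmaSeries 1 2 - sigmaSeries 1 1) * theta := by
  refine toRat_injective (eq_of_forall_X_pow_dvd_sub fun N => ?_)
  have htheta := X_pow_dvd_theta_sub_gaussProd N
  have hderiv := X_pow_dvd_qDeriv htheta
  have hone := X_pow_dvd_sigmaSeries_sub_sum_lambertTerm one_ne_zero N
  have htwo := X_pow_dvd_sigmaSeries_sub_sum_lambertTerm two_ne_zero N
  rw [map_sub, qDeriv_gaussProd] at hderiv
  simp only [map_qDeriv, map_mul, map_sub, map_ofNat, Nat.cast_one, Nat.cast_ofNat]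
    at hone htwo ⊢
  set L₁ := ∑ a ∈ Finset.range N, ((a + 1 : ℕ) : ℚ⟦X⟧) * lambertTerm (X ^ (1 * (a + 1)))
  set L₂ := ∑ a ∈ Finset.range N, ((a + 1 : ℕ) : ℚ⟦X⟧) * lambertTerm (X ^ (2 * (a + 1)))
  convert dvd_add (dvd_sub hderiv (htheta.mul_left (2 * (L₂ - L₁))))
    ((dvd_sub hone htwo).mul_left (2 * toRat theta)) using 1
  ring

theorem expand_sigmaSeries (k : ℕ) : PowerSeries.expand 2 two_ne_zero (sigmaSeries k 1) =
    sigmaSeries k 2 := by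
  rw [sigmaSeries, lambert, expand_qSum two_ne_zero, sigmaSeries,
    lambert]
  simp

theorem twelve_mul_sigmaSeries_two_sq :
    12 * sigmaSeries 1 2 ^ 2 =
      5 * sigmaSeries 3 2 + sigmaSeries 1 2 - 3 * qDeriv ℤ (sigmaSeries 1 2) := by
  have h := congrArg (PowerSeries.expand 2 two_ne_zero) twelve_mul_sigmaSeries_sq
  have hderiv := qDeriv_expand two_ne_zero (sigmaSeries 1 1)
  simp only [map_mul, map_sub, map_add, map_pow, map_ofNat, expand_sigmaSeries, Nat.cast_ofNat]
    at h hderiv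
  linear_combination h + 3 * hderiv

/-- Reduction of power series modulo `p`. -/
noncomputable def reduceMod (p : ℕ) : ℤ⟦X⟧ →+* (ZMod p)⟦X⟧ :=
  PowerSeries.map (Int.castRingHom (ZMod p))

section Reduction

variable {p : ℕ}

theorem reduceMod_qDeriv (f : ℤ⟦X⟧) :
    reduceMod p (qDeriv ℤ f) = qDeriv (ZMod p) (reduceMod p f) := map_qDeriv _ _

theorem reduceMod_qSum_congr {ι : Type*} {s : Set ι} {e : ι → ℤ} {w v : ι → ℤ} (hs : QSummable s e)
    (h : ∀ i, (w i : ZMod p) = v i) : reduceMod p (qSum s e w) = reduceMod p (qSum s e v) := by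
  rw [reduceMod, map_qSum _ hs, map_qSum _ hs]
  exact qSum_congr_coeff fun i _ => h i

theorem reduceMod_sigmaSeries_congr {k l : ℕ} (h : ∀ z : ZMod p, z ^ k = z ^ l) {d : ℤ}
    (hd : 1 ≤ d) : reduceMod p (sigmaSeries k d) = reduceMod p (sigmaSeries l d) :=
  reduceMod_qSum_congr (qSummable_lambert hd) fun x => by push_cast; exact h _

theorem reduceMod_rankSeries_congr {k l : ℕ} (h : ∀ z : ZMod p, z ^ k = z ^ l) :
    reduceMod p (rankSeries k) = reduceMod p (rankSeries l) :=
  reduceMod_qSum_congr qSummable_rankSeries fun x => by push_cast; rw [h]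

theorem reduceMod_thetaMoment_congr {k l : ℕ} (h : ∀ z : ZMod p, z ^ k = z ^ l) :
    reduceMod p (thetaMoment k) = reduceMod p (thetaMoment l) :=
  reduceMod_qSum_congr (qSummable_sq _) fun t => by push_cast; rw [h]

theorem isUnit_theta : IsUnit theta := by
  have h : constantCoeff theta = 1 := by
    rw [← coeff_zero_eq_constantCoeff_apply, theta, thetaMoment,
      coeff_qSum_eq_sum {0} 0 (fun t _ ht => by simpa using ht) (fun _ _ => Set.mem_univ _)]
    simp [intSign]
  exact isUnit_iff_constantCoeff.mpr (h ▸ isUnit_one)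

theorem coeff_reduceMod_sptSeries (n : ℕ) :
    coeff n (reduceMod p sptSeries) = (sptBar n : ZMod p) := by
  simp [reduceMod, sptSeries]

theorem coeff_reduceMod_sptSeriesEven (n : ℕ) :
    coeff n (reduceMod p sptSeriesEven) = (sptBar2 n : ZMod p) := by
  simp [reduceMod, sptSeriesEven]

theorem natCast_self_eq_zero_powerSeries : ((p : ℕ) : (ZMod p)⟦X⟧) = 0 := by
  rw [← map_natCast (C (R := ZMod p)), ZMod.natCast_self, map_zero]

theorem reduceMod_theta_mul_sptSeriesEven :
    reduceMod p theta * reduceMod p sptSeriesEven =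
      2 * reduceMod p (sigmaSeries 1 2) + 4 * reduceMod p (rankSeries 1) := by
  simpa only [map_add, map_mul, map_ofNat] using congrArg (reduceMod p) theta_mul_sptSeriesEven

theorem reduceMod_theta_mul_sptSeries :
    reduceMod p theta * reduceMod p sptSeries = 2 * reduceMod p (sigmaSeries 1 1) -
      4 * reduceMod p (sigmaSeries 1 2) + 8 * reduceMod p (rankSeries 1) := by
  simpa only [map_add, map_sub, map_mul, map_ofNat] using congrArg (reduceMod p) theta_mul_sptSeries

theorem qDeriv_reduceMod_theta : qDeriv (ZMod p) (reduceMod p theta) =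
    2 * (reduceMod p (sigmaSeries 1 2) - reduceMod p (sigmaSeries 1 1)) * reduceMod p theta := by
  simpa only [map_sub, map_mul, map_ofNat, reduceMod_qDeriv] using
    congrArg (reduceMod p) qDeriv_theta

end Reduction

section Algebra

variable {R A : Type*} [CommRing R] [CommRing A] [Algebra R A] (D : Derivation R A A)

theorem derivation_ofNat (n : ℕ) [n.AtLeastTwo] : D (OfNat.ofNat n : A) = 0 := D.map_natCast n

variable {φ ρ F G S T s t a : A}

theorem derivation_right_inverse {y : A} (hρ : φ * ρ = 1) (hφ : D φ = y * φ) : D ρ = -y * ρ := by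
  rw [D.leibniz_of_mul_eq_one ((mul_comm ρ φ).trans hρ), hφ, smul_eq_mul]
  linear_combination -y * ρ * hρ

theorem add_derivation_eq_zero_of_three_eq_zero (h3 : (3 : A) = 0) (hφ : IsUnit φ)
    (hS : φ * S = 2 * t + 4 * F)
    (hF : 8 * (φ * D F + φ * F - D φ * F) =
      16 * D φ * t + 8 * φ * t - 4 * φ * D t + D (D φ) - D φ)
    (hφ' : D (D φ) = D φ) : S + D S = 0 := by
  have h := congrArg D hS
  simp only [map_add, D.leibniz, smul_eq_mul, derivation_ofNat D] at h
  refine (hφ.mul hφ).mul_left_cancel ?_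
  linear_combination (norm := grind) φ * hS + φ * h - D φ * hS + 2 * hF + 2 * hφ'

theorem sub_eq_derivation_of_three_eq_zero (h3 : (3 : A) = 0) (hρ : φ * ρ = 1)
    (hφ : D φ = 2 * (t - s) * φ) (hS : φ * S = 2 * t + 4 * F)
    (hT : φ * T = 2 * s - 4 * t + 8 * F) : T - 2 * S = D ρ := by
  rw [derivation_right_inverse D hρ hφ]
  linear_combination (norm := grind) (2 * S - T) * hρ + ρ * hT - 2 * ρ * hS

theorem heat_one_of_five_eq_zero (h5 : (5 : A) = 0) (hφ : IsUnit φ)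
    (hφ' : D φ = 2 * (t - s) * φ) (hs : D s = s - 2 * s ^ 2) (ht : D t = t ^ 2 + 2 * t)
    (hF : 8 * (φ * D F + φ * G - D φ * F) =
      16 * D φ * t + 8 * φ * a - 4 * φ * D t + D (D φ) - D φ) :
    D F + G = 2 * (t - s) * F + 3 * t ^ 2 + 3 * t + s ^ 2 + a := by
  simp only [hφ', D.leibniz, map_sub, derivation_ofNat D, smul_eq_mul, hs, ht] at hF
  refine hφ.mul_left_cancel ?_
  linear_combination (norm := grind) 2 * hF

theorem heat_three_of_five_eq_zero (h5 : (5 : A) = 0) (hφ : IsUnit φ)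
    (hφ' : D φ = 2 * (t - s) * φ) (hs : D s = s - 2 * s ^ 2) (ht : D t = t ^ 2 + 2 * t)
    (hG : 24 * (φ * D G + φ * F - D φ * G) =
      48 * D (D φ) * t + 216 * D φ * a - 108 * D φ * D t + 24 * φ * t - 36 * φ * D a +
        12 * φ * D (D t) + D (D (D φ)) - 2 * D (D φ) + D φ) :
    D G + F = 2 * (t - s) * G + D a + 3 * t * a + 2 * s * a + 4 * t ^ 2 + t + 2 * s ^ 2 +
      3 * s ^ 3 + 4 * t * s + 3 * t * s ^ 2 + 4 * t ^ 2 * s := by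
  simp only [hφ', D.leibniz, D.leibniz_pow, map_add, map_sub, map_zero, derivation_ofNat D,
    smul_eq_mul, nsmul_eq_mul, hs, ht] at hG
  refine hφ.mul_left_cancel ?_
  linear_combination (norm := grind) -hG

theorem eq_derivation_sub_of_five_eq_zero (h5 : (5 : A) = 0) (hρ : φ * ρ = 1)
    (hφ : D φ = 2 * (t - s) * φ) (hs : D s = s - 2 * s ^ 2) (ht : D t = t ^ 2 + 2 * t)
    (hF : D F + G = 2 * (t - s) * F + 3 * t ^ 2 + 3 * t + s ^ 2 + a)
    (hG : D G + F = 2 * (t - s) * G + D a + 3 * t * a + 2 * s * a + 4 * t ^ 2 + t + 2 * s ^ 2 +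
      3 * s ^ 3 + 4 * t * s + 3 * t * s ^ 2 + 4 * t ^ 2 * s)
    (hS : φ * S = 2 * t + 4 * F) :
    ∃ H, S = D H - 3 * H := by
  -- Up to polynomials in `s`, `t`, `a`, `D` sends `ρ * F` to `-ρ * G` and `ρ * G` to `-ρ * F`, so
  -- `D - 3` sends `ρ * (F - 2 * G)` to `4 * ρ * F`; the other terms solve a linear system.
  refine ⟨ρ * (F - 2 * G + 2 * a + 2 * s ^ 2 - t ^ 2 - t), ?_⟩
  simp only [map_add, map_sub, D.leibniz, D.leibniz_pow, smul_eq_mul, nsmul_eq_mul,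
    derivation_ofNat D, hs, ht, derivation_right_inverse D hρ hφ]
  linear_combination (norm := grind) ρ * hS - S * hρ - ρ * hF + 2 * ρ * hG

theorem eq_derivation_of_five_eq_zero (h5 : (5 : A) = 0) (hρ : φ * ρ = 1)
    (hφ : D φ = 2 * (t - s) * φ) (hs : D s = s - 2 * s ^ 2) (ht : D t = t ^ 2 + 2 * t)
    (hG : D G + F = 2 * (t - s) * G + D a + 3 * t * a + 2 * s * a + 4 * t ^ 2 + t + 2 * s ^ 2 +
      3 * s ^ 3 + 4 * t * s + 3 * t * s ^ 2 + 4 * t ^ 2 * s)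
    (hS : φ * S = 2 * s - 6 * t + 4 * F) :
    ∃ H, S = D H := by
  refine ⟨ρ * (G - a - s ^ 2 - 2 * t ^ 2 - 2 * s + t + 2), ?_⟩
  simp only [map_add, map_sub, D.leibniz, D.leibniz_pow, smul_eq_mul, nsmul_eq_mul,
    derivation_ofNat D, hs, ht, derivation_right_inverse D hρ hφ]
  linear_combination (norm := grind) ρ * hS - S * hρ + 4 * ρ * hG

end Algebra

theorem sptSeriesEven_add_qDeriv_mod_three :
    reduceMod 3 sptSeriesEven + qDeriv (ZMod 3) (reduceMod 3 sptSeriesEven) = 0 := by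
  have hpow : ∀ z : ZMod 3, z ^ 3 = z ^ 1 := by decide
  have hσ : reduceMod 3 (sigmaSeries 3 2) = _ := reduceMod_sigmaSeries_congr hpow one_le_two
  have hR : reduceMod 3 (rankSeries (1 + 2)) = _ := reduceMod_rankSeries_congr hpow
  have hθ : reduceMod 3 (thetaMoment 4) = reduceMod 3 (thetaMoment 2) :=
    reduceMod_thetaMoment_congr (by decide)
  have hheat := congrArg (reduceMod 3) eight_mul_heatSeries_one
  rw [← qDeriv_thetaMoment 2, ← qDeriv_thetaMoment 0, ← theta] at hθ
  simp only [heatSeries, map_mul, map_add, map_sub, map_ofNat, reduceMod_qDeriv, hσ, hR]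
    at hheat hθ
  exact add_derivation_eq_zero_of_three_eq_zero _ natCast_self_eq_zero_powerSeries
    (isUnit_theta.map _) reduceMod_theta_mul_sptSeriesEven hheat hθ

theorem exists_sptSeries_sub_eq_qDeriv_mod_three :
    ∃ H, reduceMod 3 sptSeries - 2 * reduceMod 3 sptSeriesEven = qDeriv (ZMod 3) H := by
  obtain ⟨ρ, hρ⟩ := (isUnit_theta.map (reduceMod 3)).exists_right_inv
  exact ⟨ρ, sub_eq_derivation_of_three_eq_zero _ natCast_self_eq_zero_powerSeries hρ
    qDeriv_reduceMod_theta reduceMod_theta_mul_sptSeriesEven reduceMod_theta_mul_sptSeries⟩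

theorem five_eq_zero_powerSeries : (5 : (ZMod 5)⟦X⟧) = 0 := natCast_self_eq_zero_powerSeries

theorem qDeriv_sigmaSeries_one_mod_five :
    qDeriv (ZMod 5) (reduceMod 5 (sigmaSeries 1 1)) =
      reduceMod 5 (sigmaSeries 1 1) - 2 * reduceMod 5 (sigmaSeries 1 1) ^ 2 := by
  have h := congrArg (reduceMod 5) twelve_mul_sigmaSeries_sq
  simp only [map_mul, map_add, map_sub, map_pow, map_ofNat, reduceMod_qDeriv] at h
  have h5 := five_eq_zero_powerSeries
  linear_combination (norm := grind) h

theorem qDeriv_sigmaSeries_two_mod_five :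
    qDeriv (ZMod 5) (reduceMod 5 (sigmaSeries 1 2)) =
      reduceMod 5 (sigmaSeries 1 2) ^ 2 + 2 * reduceMod 5 (sigmaSeries 1 2) := by
  have h := congrArg (reduceMod 5) twelve_mul_sigmaSeries_two_sq
  simp only [map_mul, map_add, map_sub, map_pow, map_ofNat, reduceMod_qDeriv] at h
  have h5 := five_eq_zero_powerSeries
  linear_combination (norm := grind) 2 * h

theorem qDeriv_rankSeries_one_mod_five :
    qDeriv (ZMod 5) (reduceMod 5 (rankSeries 1)) + reduceMod 5 (rankSeries 3) =
      2 * (reduceMod 5 (sigmaSeries 1 2) - reduceMod 5 (sigmaSeries 1 1)) *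
          reduceMod 5 (rankSeries 1) +
        3 * reduceMod 5 (sigmaSeries 1 2) ^ 2 + 3 * reduceMod 5 (sigmaSeries 1 2) +
        reduceMod 5 (sigmaSeries 1 1) ^ 2 + reduceMod 5 (sigmaSeries 3 2) := by
  have h := congrArg (reduceMod 5) eight_mul_heatSeries_one
  simp only [heatSeries, map_mul, map_add, map_sub, map_ofNat, reduceMod_qDeriv] at h
  exact heat_one_of_five_eq_zero _ five_eq_zero_powerSeries (isUnit_theta.map _)
    qDeriv_reduceMod_theta qDeriv_sigmaSeries_one_mod_five qDeriv_sigmaSeries_two_mod_five h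

theorem qDeriv_rankSeries_three_mod_five :
    qDeriv (ZMod 5) (reduceMod 5 (rankSeries 3)) + reduceMod 5 (rankSeries 1) =
      2 * (reduceMod 5 (sigmaSeries 1 2) - reduceMod 5 (sigmaSeries 1 1)) *
          reduceMod 5 (rankSeries 3) +
        qDeriv (ZMod 5) (reduceMod 5 (sigmaSeries 3 2)) +
        3 * reduceMod 5 (sigmaSeries 1 2) * reduceMod 5 (sigmaSeries 3 2) +
        2 * reduceMod 5 (sigmaSeries 1 1) * reduceMod 5 (sigmaSeries 3 2) +
        4 * reduceMod 5 (sigmaSeries 1 2) ^ 2 + reduceMod 5 (sigmaSeries 1 2) +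
        2 * reduceMod 5 (sigmaSeries 1 1) ^ 2 + 3 * reduceMod 5 (sigmaSeries 1 1) ^ 3 +
        4 * reduceMod 5 (sigmaSeries 1 2) * reduceMod 5 (sigmaSeries 1 1) +
        3 * reduceMod 5 (sigmaSeries 1 2) * reduceMod 5 (sigmaSeries 1 1) ^ 2 +
        4 * reduceMod 5 (sigmaSeries 1 2) ^ 2 * reduceMod 5 (sigmaSeries 1 1) := by
  have hpow : ∀ z : ZMod 5, z ^ 5 = z ^ 1 := by decide
  have hσ : reduceMod 5 (sigmaSeries 5 2) = _ := reduceMod_sigmaSeries_congr hpow one_le_two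
  have hR : reduceMod 5 (rankSeries (3 + 2)) = _ := reduceMod_rankSeries_congr hpow
  have h := congrArg (reduceMod 5) twenty_four_mul_heatSeries_three
  simp only [heatSeries, map_mul, map_add, map_sub, map_ofNat, reduceMod_qDeriv, hσ, hR] at h
  exact heat_three_of_five_eq_zero _ five_eq_zero_powerSeries (isUnit_theta.map _)
    qDeriv_reduceMod_theta qDeriv_sigmaSeries_one_mod_five qDeriv_sigmaSeries_two_mod_five h

theorem exists_sptSeriesEven_eq_qDeriv_sub_mod_five :
    ∃ H, reduceMod 5 sptSeriesEven = qDeriv (ZMod 5) H - 3 * H := by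
  obtain ⟨ρ, hρ⟩ := (isUnit_theta.map (reduceMod 5)).exists_right_inv
  exact eq_derivation_sub_of_five_eq_zero _ five_eq_zero_powerSeries hρ qDeriv_reduceMod_theta
    qDeriv_sigmaSeries_one_mod_five qDeriv_sigmaSeries_two_mod_five qDeriv_rankSeries_one_mod_five
    qDeriv_rankSeries_three_mod_five reduceMod_theta_mul_sptSeriesEven

theorem exists_sptSeries_sub_sptSeriesEven_eq_qDeriv_mod_five :
    ∃ H, reduceMod 5 sptSeries - reduceMod 5 sptSeriesEven = qDeriv (ZMod 5) H := by
  obtain ⟨ρ, hρ⟩ := (isUnit_theta.map (reduceMod 5)).exists_right_inv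
  refine eq_derivation_of_five_eq_zero _ five_eq_zero_powerSeries hρ qDeriv_reduceMod_theta
    qDeriv_sigmaSeries_one_mod_five qDeriv_sigmaSeries_two_mod_five
    qDeriv_rankSeries_three_mod_five ?_
  linear_combination reduceMod_theta_mul_sptSeries (p := 5) -
    reduceMod_theta_mul_sptSeriesEven (p := 5)

theorem sptBar2_mod_three {n : ℕ} (hn : (n : ZMod 3) + 1 ≠ 0) : (sptBar2 n : ZMod 3) = 0 := by
  have h := congrArg (coeff n) sptSeriesEven_add_qDeriv_mod_three
  rw [map_add, coeff_qDeriv, coeff_reduceMod_sptSeriesEven, map_zero] at h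
  have : Fact (Nat.Prime 3) := ⟨Nat.prime_three⟩
  refine (mul_eq_zero.mp ?_).resolve_left hn
  linear_combination h

theorem sptBar_mod_three {n : ℕ} (hn : (n : ZMod 3) = 0) : (sptBar n : ZMod 3) = 0 := by
  obtain ⟨H, hH⟩ := exists_sptSeries_sub_eq_qDeriv_mod_three
  have h := congrArg (coeff n) hH
  have heven : (sptBar2 n : ZMod 3) = 0 := sptBar2_mod_three (by rw [hn]; decide)
  rwa [two_mul, map_sub, map_add, coeff_qDeriv, coeff_reduceMod_sptSeries,
    coeff_reduceMod_sptSeriesEven, heven, hn, add_zero, sub_zero, zero_mul] at h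

theorem sptBar2_mod_five {n : ℕ} (hn : (n : ZMod 5) = 3) : (sptBar2 n : ZMod 5) = 0 := by
  obtain ⟨H, hH⟩ := exists_sptSeriesEven_eq_qDeriv_sub_mod_five
  have h := congrArg (coeff n) hH
  rwa [map_sub, coeff_qDeriv, coeff_reduceMod_sptSeriesEven, ← map_ofNat (C (R := ZMod 5)),
    coeff_C_mul, hn, sub_self] at h

theorem sptBar1_mod_five {n : ℕ} (hn : (n : ZMod 5) = 0) : (sptBar1 n : ZMod 5) = 0 := by
  obtain ⟨H, hH⟩ := exists_sptSeries_sub_sptSeriesEven_eq_qDeriv_mod_five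
  have h := congrArg (coeff n) hH
  rwa [map_sub, coeff_qDeriv, coeff_reduceMod_sptSeriesEven, coeff_reduceMod_sptSeries, sptBar,
    Nat.cast_add, add_sub_cancel_right, hn, zero_mul] at h

theorem theorem1p3 :
    (∀ n : ℕ, sptBar2 (3 * n) ≡ 0 [MOD 3] ∧ sptBar2 (3 * n + 1) ≡ 0 [MOD 3]) ∧
    (∀ n : ℕ, sptBar (3 * n) ≡ 0 [MOD 3]) ∧
    (∀ n : ℕ, sptBar2 (5 * n + 3) ≡ 0 [MOD 5]) ∧
    (∀ n : ℕ, sptBar1 (5 * n) ≡ 0 [MOD 5]) := by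
  simp only [Nat.modEq_zero_iff_dvd, ← ZMod.natCast_eq_zero_iff]
  have h3 (n : ℕ) : ((3 * n : ℕ) : ZMod 3) = 0 :=
    (ZMod.natCast_eq_zero_iff _ _).mpr (dvd_mul_right 3 n)
  have h5 (n : ℕ) : ((5 * n : ℕ) : ZMod 5) = 0 :=
    (ZMod.natCast_eq_zero_iff _ _).mpr (dvd_mul_right 5 n)
  refine ⟨fun n => ⟨sptBar2_mod_three ?_, sptBar2_mod_three ?_⟩,
    fun n => sptBar_mod_three (h3 n), fun n => sptBar2_mod_five ?_,
    fun n => sptBar1_mod_five (h5 n)⟩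
  · rw [h3]; decide
  · rw [Nat.cast_add, h3]; decide
  · rw [Nat.cast_add, h5]; decide
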